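/- Let $\Gamma$ be a discrete group, $\mathcal L(\Gamma)\subseteq B(\ell^2(\Gamma))$ its group von Neumann algebra with canonical trace $\tau(x)=\langle x\delta_e,\delta_e\rangle$, and identify $L^2(\mathcal L(\Gamma),\tau)$ with $\ell^2(\Gamma)$ via $x\mapsto x\Omega$, $\Omega=\delta_e$. A quantum Markov semigroup on $\mathcal L(\Gamma)$ is a semigroup $(\Phi_t)_{t\ge 0}$ of unital completely positive maps on $\mathcal L(\Gamma)$ with $\Phi_0=\mathrm{id}$, $\tau\circ\Phi_t=\tau$, $\tau(\Phi_t(x)y)=\tau(x\Phi_t(y))$, and $t\mapsto\Phi_t(x)$ strongly continuous for every $x$. Its generator $\Delta\ge 0$ is the self-adjoint operator on $\ell^2(\Gamma)$ for which $\exp(-t\Delta)$ is the bounded extension $\Phi_t^{(2)}$ of $x\Omega\mapsto\Phi_t(x)\Omega$; that is, $\Delta\xi=\lim_{t\searrow0}\frac1t(\xi-\Phi_t^{(2)}\xi)$ on the vectors $\xi$ for which the limit exists. For $1\le p\le\infty$, let $\mathcal S_p$ be the Schatten class of bounded operators $T$ with $\mathrm{Tr}(|T|^p)<\infty$ (for $p=\infty$: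 the compact operators). If $\mathbb C[\Gamma]\Omega\subseteq\mathrm{dom}(\Delta)$, the semigroup is called gradient-$\mathcal S_p$ if for all $a,b\in\mathbb C[\Gamma]$ the map $$x\Omega\mapsto-\tfrac12\big(\Delta(axb)+a\Delta(x)b-\Delta(ax)b-a\Delta(xb)\big),\qquad x\in\mathbb C[\Gamma],$$ (where $\Delta(y)$ means $\Delta(y\Omega)$, and $\mathbb C[\Gamma]$ acts on $\ell^2(\Gamma)$ from the left and the right by the regular representations) extends to a bounded operator on $\ell^2(\Gamma)$ that lies in $\mathcal S_p$. Given a quantum Markov semigroup $(\Phi_t)$ on $\mathcal L(\Gamma)$, let $\Psi_t=\mathbb E\circ(\Phi_t\otimes\mathrm{id})\circ\delta_\Gamma$ be its average, where $\delta_\Gamma(\gamma)=\gamma\otimes\gamma$ is the comultiplication and $\mathbb E$ is the trace-preserving conditional expectation of $\mathcal L(\Gamma)\,\overline\otimes\,\mathcal L(\Gamma)$ onto the image of $\delta_\Gamma$, followed by $\delta_\Gamma^{-1}$. **Theorem.** Let $1\le p\le\infty$ and let $(\Phi_t)_{t\ge0}$ be a quantum Markov semigroup on $\mathcal L(\Gamma)$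 such that $\mathbb C[\Gamma]\Omega$ is contained in the domain of its generator $\Delta$. If $(\Phi_t)$ is gradient-$\mathcal S_p$, then the limits $\Delta_0^\Psi(\gamma)=\lim_{t\searrow0}\frac1t(\gamma-\Psi_t(\gamma))$, $\gamma\in\Gamma$, exist and define a closable operator on $\ell^2(\Gamma)$ with domain $\mathbb C[\Gamma]\Omega$; its closure $\Delta^\Psi$ is the generator of a quantum Markov semigroup $\exp(-t\Delta^\Psi)$ of Fourier multipliers on $\mathcal L(\Gamma)$; and $\exp(-t\Delta^\Psi)$ is gradient-$\mathcal S_p$. -/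

import Mathlib

open scoped NNReal ENNReal Topology TensorProduct

noncomputable section

namespace GroupQMS

/-! ### The Hilbert space `ℓ²(α)` and the regular representations -/

/-- The complex Hilbert space `ℓ²(α)`. -/
abbrev Ell2 (α : Type*) : Type _ := lp (fun _ : α => ℂ) 2

open Classical in
/-- The standard basis vector `δ_a` of `ℓ²(α)`. -/
def delta {α : Type*} (a : α) : Ell2 α := lp.single 2 a (1 : ℂ)

theorem inner_delta_left {α : Type*} (a : α) (ξ : Ell2 α) : inner ℂ (delta a) ξ = ξ a := by
  classical
  unfold delta
  rw [lp.inner_single_left]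
  simp

open Classical in
theorem delta_apply {α : Type*} (a b : α) : delta a b = if b = a then 1 else 0 := by
  unfold delta
  rw [lp.coeFn_single, Pi.single_apply]

theorem orthonormal_delta (α : Type*) : Orthonormal ℂ (delta : α → Ell2 α) := by
  classical
  rw [orthonormal_iff_ite]
  intro i j
  rw [inner_delta_left, delta_apply]

theorem Ell2.ext_inner {α : Type*} {ξ η : Ell2 α} (h : ∀ a, ξ a = η a) : ξ = η :=
  lp.ext (funext h)

/-- Two bounded operators on `ℓ²(α)` that agree on the standard basis are equal. -/
theorem clm_ext {α : Type*} {F : Type*} [NormedAddCommGroup F] [NormedSpace ℂ F]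
    {S T : Ell2 α →L[ℂ] F} (h : ∀ a, S (delta a) = T (delta a)) : S = T := by
  classical
  ext ξ
  have h2 : (2 : ℝ≥0∞) ≠ ⊤ := by simp
  have hs := lp.hasSum_single (p := 2) h2 ξ
  have key : ∀ a, S (lp.single 2 a (ξ a)) = T (lp.single 2 a (ξ a)) := by
    intro a
    have : lp.single 2 a (ξ a) = ξ a • (delta a : Ell2 α) := by
      unfold delta
      rw [← lp.single_smul]
      simp
    rw [this, map_smul, map_smul, h]
  have h1 := S.hasSum hs
  have h3 := T.hasSum hs
  simp only [key] at h1
  exact h1.unique h3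

/-- For an injective map `f : α → β`, the isometry `ℓ²(α) → ℓ²(β)` with `δ_a ↦ δ_{f a}`. -/
def l2Map {α β : Type*} (f : α ↪ β) : Ell2 α →ₗᵢ[ℂ] Ell2 β :=
  ((orthonormal_delta β).comp f f.injective).orthogonalFamily.linearIsometry

@[simp]
theorem l2Map_delta {α β : Type*} (f : α ↪ β) (a : α) : l2Map f (delta a) = delta (f a) := by
  classical
  unfold l2Map
  conv_lhs => rw [delta]
  rw [OrthogonalFamily.linearIsometry_apply_single]
  simp

/-- The left translation operator `λ_g`, `δ_h ↦ δ_{gh}`. -/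
def leftTranslation {Γ : Type*} [Group Γ] (g : Γ) : Ell2 Γ →L[ℂ] Ell2 Γ :=
  (l2Map (mulLeftEmbedding g)).toContinuousLinearMap

/-- The right translation operator `ρ_g`, `δ_h ↦ δ_{hg}`. -/
def rightTranslation {Γ : Type*} [Group Γ] (g : Γ) : Ell2 Γ →L[ℂ] Ell2 Γ :=
  (l2Map (mulRightEmbedding g)).toContinuousLinearMap

@[simp]
theorem leftTranslation_delta {Γ : Type*} [Group Γ] (g h : Γ) :
    leftTranslation g (delta h) = delta (g * h) := by
  simp [leftTranslation]

@[simp]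
theorem rightTranslation_delta {Γ : Type*} [Group Γ] (g h : Γ) :
    rightTranslation g (delta h) = delta (h * g) := by
  simp [rightTranslation]

/-! ### The group von Neumann algebra and its trace -/

/-- The group von Neumann algebra `𝓛(Γ)`: the double commutant in `B(ℓ²(Γ))` of the image of the
left regular representation. -/
def groupVN (Γ : Type*) [Group Γ] : VonNeumannAlgebra (Ell2 Γ) where
  toStarSubalgebra := StarSubalgebra.centralizer ℂ
    (StarSubalgebra.centralizer ℂ (Set.range (leftTranslation (Γ := Γ))) :
      Set (Ell2 Γ →L[ℂ] Ell2 Γ))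
  centralizer_centralizer' := by
    simp

/-- The elements of `𝓛(Γ)`. -/
abbrev GroupVN (Γ : Type*) [Group Γ] : Type _ := (groupVN Γ).toStarSubalgebra

/-- The unitary of `𝓛(Γ)` associated with a group element. -/
def groupUnitary {Γ : Type*} [Group Γ] : Γ →* GroupVN Γ where
  toFun g := ⟨leftTranslation g, by
    simp only [groupVN]
    rw [StarSubalgebra.mem_centralizer_iff]
    intro T hT
    have h1 := (StarSubalgebra.mem_centralizer_iff ℂ).1 hT _ ⟨g, rfl⟩
    have hT' : star T ∈ StarSubalgebra.centralizer ℂ (Set.range (leftTranslation (Γ := Γ))) :=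
      star_mem hT
    have h2 := (StarSubalgebra.mem_centralizer_iff ℂ).1 hT' _ ⟨g, rfl⟩
    exact ⟨h1.1.symm, h2.1.symm⟩⟩
  map_one' := by
    apply Subtype.ext
    apply clm_ext
    intro a
    simp
  map_mul' g h := by
    apply Subtype.ext
    apply clm_ext
    intro a
    simp [mul_assoc]

/-- The embedding of the group algebra `ℂ[Γ]` in `𝓛(Γ)`. -/
def ofGroupAlgebra {Γ : Type*} [Group Γ] : MonoidAlgebra ℂ Γ →ₐ[ℂ] GroupVN Γ :=
  MonoidAlgebra.lift ℂ (GroupVN Γ) Γ groupUnitary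

/-- The cyclic and separating trace vector `Ω = δ_1`. The map `x ↦ x Ω` identifies
`L²(𝓛(Γ), τ)` with `ℓ²(Γ)`. -/
def traceVec (Γ : Type*) [Group Γ] : Ell2 Γ := delta 1

/-- The canonical trace `τ(x) = ⟨x Ω, Ω⟩` of `𝓛(Γ)`. -/
def trace {Γ : Type*} [Group Γ] (x : GroupVN Γ) : ℂ :=
  inner ℂ (traceVec Γ) ((x : Ell2 Γ →L[ℂ] Ell2 Γ) (traceVec Γ))

/-- The embedding `x ↦ x Ω` of `𝓛(Γ)` in `L²(𝓛(Γ), τ) = ℓ²(Γ)`. -/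
def toL2 {Γ : Type*} [Group Γ] : GroupVN Γ →ₗ[ℂ] Ell2 Γ where
  toFun x := (x : Ell2 Γ →L[ℂ] Ell2 Γ) (traceVec Γ)
  map_add' _ _ := rfl
  map_smul' _ _ := rfl

/-- The embedding `x ↦ x Ω` of `ℂ[Γ]` in `ℓ²(Γ)`. -/
def vec {Γ : Type*} [Group Γ] : MonoidAlgebra ℂ Γ →ₗ[ℂ] Ell2 Γ :=
  toL2 ∘ₗ ofGroupAlgebra.toLinearMap

/-- The left action `ξ ↦ a ξ` of `ℂ[Γ]` on the bimodule `L²(𝓛(Γ), τ) = ℓ²(Γ)`. -/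
def leftAct {Γ : Type*} [Group Γ] (a : MonoidAlgebra ℂ Γ) : Ell2 Γ →L[ℂ] Ell2 Γ :=
  (ofGroupAlgebra a : GroupVN Γ)

/-- The right action `ξ ↦ ξ b` of `ℂ[Γ]` on the bimodule `L²(𝓛(Γ), τ) = ℓ²(Γ)`: the linear
extension of `g ↦ ρ_g`. -/
def rightAct {Γ : Type*} [Group Γ] (b : MonoidAlgebra ℂ Γ) : Ell2 Γ →L[ℂ] Ell2 Γ :=
  b.coeff.sum fun g c => c • rightTranslation g

/-! ### Quantum Markov semigroups -/

open scoped ComplexOrder in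
/-- An `n × n` matrix with entries in `𝓛(Γ)` is positive: it acts as a positive operator on the
direct sum of `n` copies of `ℓ²(Γ)`. -/
def IsPositiveMatrix {Γ : Type*} [Group Γ] {n : ℕ} (x : Matrix (Fin n) (Fin n) (GroupVN Γ)) :
    Prop :=
  ∀ ξ : Fin n → Ell2 Γ,
    0 ≤ ∑ i, ∑ j, inner ℂ (ξ i) ((x i j : Ell2 Γ →L[ℂ] Ell2 Γ) (ξ j))

/-- A linear map on `𝓛(Γ)` is completely positive if all its matrix amplifications preserve
positivity. -/
def IsCompletelyPositive {Γ : Type*} [Group Γ] (T : GroupVN Γ →ₗ[ℂ] GroupVN Γ) : Prop :=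
  ∀ (n : ℕ) (x : Matrix (Fin n) (Fin n) (GroupVN Γ)),
    IsPositiveMatrix x → IsPositiveMatrix (x.map T)

/-- A quantum Markov semigroup on `(𝓛(Γ), τ)`: a semigroup of unital completely positive,
trace-preserving, symmetric maps, pointwise continuous in time for the strong topology. -/
structure QMS (Γ : Type*) [Group Γ] where
  /-- The map at time `t`. -/
  toFun : ℝ≥0 → (GroupVN Γ →ₗ[ℂ] GroupVN Γ)
  map_zero : toFun 0 = LinearMap.id
  map_add : ∀ s t, toFun (s + t) = toFun s ∘ₗ toFun t
  map_one : ∀ t, toFun t 1 = 1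
  completelyPositive : ∀ t, IsCompletelyPositive (toFun t)
  trace_map : ∀ t x, trace (toFun t x) = trace x
  symmetric : ∀ t x y, trace (toFun t x * y) = trace (x * toFun t y)
  continuous : ∀ (x : GroupVN Γ) (ξ : Ell2 Γ),
    Continuous fun t => (toFun t x : Ell2 Γ →L[ℂ] Ell2 Γ) ξ

/-- The extension `Φ_t⁽²⁾` of `x Ω ↦ Φ_t(x) Ω` to a bounded operator on `L²(𝓛(Γ), τ) = ℓ²(Γ)`;
see `QMS.l2_toL2` below. -/
def QMS.l2 {Γ : Type*} [Group Γ] (Φ : QMS Γ) (t : ℝ≥0) : Ell2 Γ →L[ℂ] Ell2 Γ :=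
  (toL2 ∘ₗ Φ.toFun t).extendOfNorm toL2

theorem denseRange_toL2 (Γ : Type*) [Group Γ] :
    DenseRange (toL2 : GroupVN Γ →ₗ[ℂ] Ell2 Γ) := by
  classical
  have hmem : ∀ a : Γ, (delta a : Ell2 Γ) ∈ LinearMap.range (toL2 (Γ := Γ)) := by
    intro a
    refine ⟨groupUnitary a, ?_⟩
    change leftTranslation a (delta 1) = delta a
    simp
  intro ξ
  have hs := lp.hasSum_single (p := 2) (by simp : (2 : ℝ≥0∞) ≠ ⊤) ξ
  have hmem' : ∀ s : Finset Γ,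
      (∑ a ∈ s, lp.single 2 a (ξ a) : Ell2 Γ) ∈ Set.range (toL2 (Γ := Γ)) := by
    intro s
    change _ ∈ LinearMap.range (toL2 (Γ := Γ))
    refine Submodule.sum_mem _ fun a _ => ?_
    have : lp.single 2 a (ξ a) = ξ a • (delta a : Ell2 Γ) := by
      unfold delta
      rw [← lp.single_smul]
      simp
    rw [this]
    exact Submodule.smul_mem _ _ (hmem a)
  exact mem_closure_of_tendsto hs (Filter.Eventually.of_forall hmem')

open scoped ComplexOrder in
/-- The `L²`-contractivity of the maps of a quantum Markov semigroup. -/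
theorem QMS.norm_toL2_le {Γ : Type*} [Group Γ] (Φ : QMS Γ) (t : ℝ≥0) (x : GroupVN Γ) :
    ‖toL2 (Φ.toFun t x)‖ ≤ ‖toL2 x‖ := by
  have hpos : IsPositiveMatrix !![star x * x, star x; x, 1] := by
    intro ξ
    have hadj : ∀ u v : Ell2 Γ, inner ℂ u (((star x : GroupVN Γ) : Ell2 Γ →L[ℂ] Ell2 Γ) v)
        = inner ℂ ((x : Ell2 Γ →L[ℂ] Ell2 Γ) u) v := fun u v =>
      ContinuousLinearMap.adjoint_inner_right (x : Ell2 Γ →L[ℂ] Ell2 Γ) u v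
    have hsum : (∑ i, ∑ j, inner ℂ (ξ i)
        (((!![star x * x, star x; x, 1] : Matrix (Fin 2) (Fin 2) (GroupVN Γ)) i j :
          Ell2 Γ →L[ℂ] Ell2 Γ) (ξ j)))
        = inner ℂ ((x : Ell2 Γ →L[ℂ] Ell2 Γ) (ξ 0) + ξ 1)
            ((x : Ell2 Γ →L[ℂ] Ell2 Γ) (ξ 0) + ξ 1) := by
      have e1 : inner ℂ (ξ 0) (((star x * x : GroupVN Γ) : Ell2 Γ →L[ℂ] Ell2 Γ) (ξ 0))
          = inner ℂ ((x : Ell2 Γ →L[ℂ] Ell2 Γ) (ξ 0)) ((x : Ell2 Γ →L[ℂ] Ell2 Γ) (ξ 0)) :=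
        hadj _ _
      have e2 : inner ℂ (ξ 1) (((1 : GroupVN Γ) : Ell2 Γ →L[ℂ] Ell2 Γ) (ξ 1))
          = inner ℂ (ξ 1) (ξ 1) := rfl
      simp only [Fin.sum_univ_two, Matrix.of_apply, Matrix.cons_val', Matrix.cons_val_zero,
        Matrix.cons_val_one, Matrix.cons_val_fin_one]
      rw [e1, e2, hadj, inner_add_left, inner_add_right, inner_add_right]
    rw [hsum, inner_self_eq_norm_sq_to_K]
    positivity
  have hΦ := Φ.completelyPositive t 2 _ hpos
  set y := Φ.toFun t x with hy
  set η : Ell2 Γ := toL2 y with hη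
  set s : ℂ := inner ℂ (traceVec Γ) ((Φ.toFun t (star x) : Ell2 Γ →L[ℂ] Ell2 Γ) η) with hs
  have hA : inner ℂ (traceVec Γ) ((Φ.toFun t (star x * x) : Ell2 Γ →L[ℂ] Ell2 Γ) (traceVec Γ))
      = ((‖toL2 x‖ : ℂ)) ^ 2 := by
    refine (Φ.trace_map t (star x * x)).trans ?_
    refine (ContinuousLinearMap.adjoint_inner_right (x : Ell2 Γ →L[ℂ] Ell2 Γ) _ _).trans ?_
    exact inner_self_eq_norm_sq_to_K (𝕜 := ℂ) (toL2 x)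
  have key : ∀ c : ℂ, 0 ≤ ((‖toL2 x‖ : ℂ)) ^ 2 + c * s
      + (starRingEnd ℂ c * ((‖η‖ : ℂ)) ^ 2 + starRingEnd ℂ c * (c * ((‖η‖ : ℂ)) ^ 2)) := by
    intro c
    have h := hΦ ![traceVec Γ, c • η]
    simp only [Fin.sum_univ_two, Matrix.of_apply, Matrix.cons_val', Matrix.cons_val_zero,
      Matrix.cons_val_one, Matrix.cons_val_fin_one, Matrix.map_apply, Φ.map_one, hA, map_smul,
      inner_smul_left, inner_smul_right] at h
    have e1 : inner ℂ η ((y : Ell2 Γ →L[ℂ] Ell2 Γ) (traceVec Γ)) = ((‖η‖ : ℂ)) ^ 2 :=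
      inner_self_eq_norm_sq_to_K (𝕜 := ℂ) η
    have e2 : inner ℂ η (((1 : GroupVN Γ) : Ell2 Γ →L[ℂ] Ell2 Γ) η) = ((‖η‖ : ℂ)) ^ 2 :=
      inner_self_eq_norm_sq_to_K (𝕜 := ℂ) η
    rw [← hy, e1, e2] at h
    linear_combination (exp := 1) h
  have h1 := (Complex.le_def.1 (key (-1))).1
  have h2 := (Complex.le_def.1 (key Complex.I)).2
  simp [← Complex.ofReal_pow] at h1 h2
  refine abs_le_of_sq_le_sq' ?_ (norm_nonneg _) |>.2
  linarith

/-- `Φ_t⁽²⁾` does extend `x Ω ↦ Φ_t(x) Ω`. -/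
theorem QMS.l2_toL2 {Γ : Type*} [Group Γ] (Φ : QMS Γ) (t : ℝ≥0) (x : GroupVN Γ) :
    Φ.l2 t (toL2 x) = toL2 (Φ.toFun t x) :=
  LinearMap.extendOfNorm_eq (denseRange_toL2 Γ)
    ⟨1, fun y => by simpa using Φ.norm_toL2_le t y⟩ x

/-- The generator `Δ` of a quantum Markov semigroup, with the sign convention
`exp(-t Δ) = Φ_t⁽²⁾`: the unbounded operator on `ℓ²(Γ)` given by
`Δ ξ = lim_{t ↘ 0} t⁻¹ (ξ - Φ_t⁽²⁾ ξ)` on the vectors `ξ` for which the limit exists. -/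
def QMS.generator {Γ : Type*} [Group Γ] (Φ : QMS Γ) : Ell2 Γ →ₗ.[ℂ] Ell2 Γ where
  domain :=
    { carrier := {ξ | ∃ η, Filter.Tendsto (fun t : ℝ≥0 => ((t : ℝ) : ℂ)⁻¹ • (ξ - Φ.l2 t ξ))
        (𝓝[>] 0) (𝓝 η)}
      zero_mem' := ⟨0, by simp⟩
      add_mem' := by
        rintro ξ ξ' ⟨η, h⟩ ⟨η', h'⟩
        refine ⟨η + η', (h.add h').congr fun t => ?_⟩
        rw [_root_.map_add, ← smul_add]
        congr 1
        abel
      smul_mem' := by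
        rintro c ξ ⟨η, h⟩
        refine ⟨c • η, (h.const_smul c).congr fun t => ?_⟩
        rw [map_smul, smul_comm, smul_sub] }
  toFun :=
    { toFun := fun ξ => ξ.2.choose
      map_add' := by
        intro ξ ξ'
        refine tendsto_nhds_unique (ξ + ξ').2.choose_spec
          ((ξ.2.choose_spec.add ξ'.2.choose_spec).congr fun t => ?_)
        rw [Submodule.coe_add, _root_.map_add, ← smul_add]
        congr 1
        abel
      map_smul' := by
        intro c ξ
        refine tendsto_nhds_unique (c • ξ).2.choose_spec
          ((ξ.2.choose_spec.const_smul c).congr fun t => ?_)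
        rw [Submodule.coe_smul, map_smul, smul_comm, smul_sub] }

/-! ### Schatten classes and the gradient condition -/

/-- The operator `|T|^p` on a complex Hilbert space, where `|T| = (T* T)^(1/2)`. -/
def absPow {H : Type*} [NormedAddCommGroup H] [InnerProductSpace ℂ H] [CompleteSpace H]
    (T : H →L[ℂ] H) (p : ℝ) : H →L[ℂ] H :=
  CFC.rpow (CFC.abs T) p

/-- The Schatten class `𝓢_p` on `ℓ²(Γ)`: for `p < ∞`, the bounded operators `T` with
`Tr |T|^p = ∑_g ⟨|T|^p δ_g, δ_g⟩ < ∞`; for `p = ∞`, the compact operators. -/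
def IsSchatten {Γ : Type*} (p : ℝ≥0∞) (T : Ell2 Γ →L[ℂ] Ell2 Γ) : Prop :=
  if p = ∞ then IsCompactOperator T
  else Summable fun g : Γ =>
    RCLike.re (inner ℂ (delta g) (absPow T p.toReal (delta g)))

/-- A quantum Markov semigroup with generator `Δ` is gradient-`𝓢_p` (relative to the algebra
`ℂ[Γ]`) if `ℂ[Γ] Ω` lies in the domain of `Δ` and, for all `a, b ∈ ℂ[Γ]`, the map
`x Ω ↦ -½ (Δ(a x b) + a Δ(x) b - Δ(a x) b - a Δ(x b))`, `x ∈ ℂ[Γ]`,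
extends to a bounded operator on `ℓ²(Γ)` that belongs to `𝓢_p`. -/
def QMS.IsGradientSchatten {Γ : Type*} [Group Γ] (Φ : QMS Γ) (p : ℝ≥0∞) : Prop :=
  ∃ hdom : ∀ x : MonoidAlgebra ℂ Γ, vec x ∈ Φ.generator.domain,
    ∀ a b : MonoidAlgebra ℂ Γ, ∃ T : Ell2 Γ →L[ℂ] Ell2 Γ, IsSchatten p T ∧
      ∀ x : MonoidAlgebra ℂ Γ,
        T (vec x) = (-(1 / 2) : ℂ) •
          (Φ.generator ⟨vec (a * x * b), hdom _⟩
            + leftAct a (rightAct b (Φ.generator ⟨vec x, hdom _⟩))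
            - rightAct b (Φ.generator ⟨vec (a * x), hdom _⟩)
            - leftAct a (Φ.generator ⟨vec (x * b), hdom _⟩))

/-! ### Averaging -/

theorem memlp_tensor {α β : Type*} (ξ : Ell2 α) (η : Ell2 β) :
    Memℓp (fun q : α × β => ξ q.1 * η q.2) 2 := by
  have h0 : 0 < (2 : ℝ≥0∞).toReal := by simp
  have h1 := (lp.memℓp ξ).summable h0
  have h2 := (lp.memℓp η).summable h0
  refine memℓp_gen ?_
  refine (h1.mul_of_nonneg h2 (fun _ => by positivity) (fun _ => by positivity)).congr fun q => ?_
  rw [norm_mul, Real.mul_rpow (norm_nonneg _) (norm_nonneg _)]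

/-- The elementary tensors `(ξ, η) ↦ ξ ⊗ η` of the Hilbert space tensor product
`ℓ²(α) ⊗ ℓ²(β) = ℓ²(α × β)`. -/
def l2Tensor {α β : Type*} : Ell2 α →ₗ[ℂ] Ell2 β →ₗ[ℂ] Ell2 (α × β) :=
  LinearMap.mk₂ ℂ (fun ξ η => ⟨fun q => ξ q.1 * η q.2, memlp_tensor ξ η⟩)
    (fun _ _ _ => lp.ext (funext fun _ => add_mul _ _ _))
    (fun _ _ _ => lp.ext (funext fun _ => mul_assoc _ _ _))
    (fun _ _ _ => lp.ext (funext fun _ => mul_add _ _ _))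
    (fun _ _ _ => lp.ext (funext fun _ => mul_left_comm _ _ _))

/-- The embedding `z ↦ z (Ω ⊗ Ω)` of the algebraic tensor product `𝓛(Γ) ⊗ 𝓛(Γ)` in
`L²(𝓛(Γ) ⊗ 𝓛(Γ), τ ⊗ τ) = ℓ²(Γ × Γ)`. -/
def tensorToL2 {Γ : Type*} [Group Γ] : GroupVN Γ ⊗[ℂ] GroupVN Γ →ₗ[ℂ] Ell2 (Γ × Γ) :=
  TensorProduct.lift (l2Tensor.compl₁₂ toL2 toL2)

/-- The comultiplication `g ↦ g ⊗ g` of `𝓛(Γ)` on the group algebra. -/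
def comult {Γ : Type*} [Group Γ] : MonoidAlgebra ℂ Γ →ₗ[ℂ] GroupVN Γ ⊗[ℂ] GroupVN Γ :=
  TensorProduct.map ofGroupAlgebra.toLinearMap ofGroupAlgebra.toLinearMap ∘ₗ
    (Coalgebra.comul : MonoidAlgebra ℂ Γ →ₗ[ℂ] MonoidAlgebra ℂ Γ ⊗[ℂ] MonoidAlgebra ℂ Γ)

/-- The comultiplication on the level of `L²`: the isometry `δ_g ↦ δ_(g,g)`. -/
def comultL2 (Γ : Type*) : Ell2 Γ →ₗᵢ[ℂ] Ell2 (Γ × Γ) :=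
  l2Map ⟨fun g => (g, g), fun _ _ h => congrArg Prod.fst h⟩

/-- The averaged maps `Ψ_t = 𝔼 ∘ (Φ_t ⊗ id) ∘ δ_Γ` on the group algebra, with values in
`L²(𝓛(Γ), τ) = ℓ²(Γ)`. Here `𝔼` is the trace-preserving conditional expectation onto the image of
the comultiplication followed by the inverse of the comultiplication; on `L²` it is the orthogonal
projection onto the range of the isometry `comultL2` followed by its inverse, which is the adjoint
of `comultL2`. -/
def QMS.average {Γ : Type*} [Group Γ] (Φ : QMS Γ) (t : ℝ≥0) :
    MonoidAlgebra ℂ Γ →ₗ[ℂ] Ell2 Γ :=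
  (ContinuousLinearMap.adjoint (comultL2 Γ).toContinuousLinearMap).toLinearMap ∘ₗ
    tensorToL2 ∘ₗ TensorProduct.map (Φ.toFun t) LinearMap.id ∘ₗ comult

/-- `D` is the operator `Δ₀^Ψ` on `ℓ²(Γ)` with domain `ℂ[Γ] Ω` and
`Δ₀^Ψ(g) = lim_{t ↘ 0} t⁻¹ (g - Ψ_t(g))` for `g ∈ Γ`, where `Ψ_t` are the averaged maps. -/
structure QMS.IsAveragedPregenerator {Γ : Type*} [Group Γ] (Φ : QMS Γ)
    (D : Ell2 Γ →ₗ.[ℂ] Ell2 Γ) : Prop where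
  domain_eq : D.domain = LinearMap.range (vec (Γ := Γ))
  tendsto : ∀ (g : Γ) (hg : vec (MonoidAlgebra.of ℂ Γ g) ∈ D.domain),
    Filter.Tendsto
      (fun t : ℝ≥0 => ((t : ℝ) : ℂ)⁻¹ •
        (vec (MonoidAlgebra.of ℂ Γ g) - Φ.average t (MonoidAlgebra.of ℂ Γ g)))
      (𝓝[>] 0) (𝓝 (D ⟨vec (MonoidAlgebra.of ℂ Γ g), hg⟩))

end GroupQMS

end

noncomputable section

namespace GroupQMS

/-! ### Diagonal operators and strong convergence on `ℓ²` -/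

/-! Write φ_t(g) for the coefficient of Φ_t(u_g)Ω at δ_g. Averaging discards all other coefficients,
so Ψ_t(g) = φ_t(g)u_g (`QMS.average_of`). As δ_g lies in the domain of Δ, (1 - φ_t(g))/t tends to
ψ(g) = ⟨Δδ_g, δ_g⟩ ≥ 0, and Δ₀^Ψ is multiplication by ψ on finitely supported vectors.

The maps Ψ_t need not form a semigroup, but complete positivity of Φ_t makes each φ_t positive
definite. By the Schur product theorem so are the powers φ_{t/n}^n, and they converge to exp(-tψ)
(`QMS.tendsto_symbol_pow`). A normalized positive definite function yields a unital completely
positive multiplier, because on a finite set it is a Gram matrix and the multiplier becomes a sum of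
compressions (`IsPosDefFun.exists_compression`). The generator of the semigroup exp(-tψ) is the
maximal multiplication operator by ψ; finitely supported vectors form a core, so it is the closure
of Δ₀^Ψ (`IsNegDefFun.generator_eq_closure`).

For group elements s, t the gradient operator of exp(-tψ) sends δ_g to c(g)δ_{sgt}, where c(g) =
-½(ψ(sgt) + ψ(g) - ψ(sg) - ψ(gt)). The same number c(g) is the (sgt, g) matrix entry of the gradient
operator T of Φ (`QMS.gradient_apply`). As g ↦ sgt is injective, T in 𝓢_p forces c into ℓ^p, or c₀
when p = ∞: polar decomposition, Cauchy–Schwarz and Jensen for p < ∞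
(`summable_inner_rpow_of_schatten`), weak nullity of the basis for p = ∞.

It remains to pass from group elements to general a, b, that is, to sums. For p < ∞ this is done
with the stronger property of being dominated, vector by vector, by a diagonal ℓ^p operator; it is
visibly stable under sums (`IsDiagDominated.add`) and implies membership in 𝓢_p by operator
monotonicity of x^s, 0 ≤ s ≤ 1 (`summable_rpow_of_le_diagonal`). -/

theorem hasSum_delta {α : Type*} (ξ : Ell2 α) : HasSum (fun a => ξ a • (delta a : Ell2 α)) ξ := by
  classical
  refine (lp.hasSum_single (p := 2) (by simp) ξ).congr_fun ?_
  intro a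
  unfold delta
  rw [← lp.single_smul]
  simp

theorem norm_sq_eq_tsum {α : Type*} (ξ : Ell2 α) : ‖ξ‖ ^ 2 = ∑' a, ‖ξ a‖ ^ 2 := by
  have h := lp.norm_rpow_eq_tsum (p := 2) (by simp) ξ
  simpa using h

theorem summable_norm_sq {α : Type*} (ξ : Ell2 α) : Summable fun a => ‖ξ a‖ ^ 2 := by
  have h := (lp.memℓp ξ).summable (by simp)
  simpa using h

theorem norm_le_norm_of_forall {α : Type*} {ξ η : Ell2 α} (h : ∀ a, ‖ξ a‖ ≤ ‖η a‖) :
    ‖ξ‖ ≤ ‖η‖ := by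
  refine abs_le_of_sq_le_sq' ?_ (norm_nonneg _) |>.2
  rw [norm_sq_eq_tsum, norm_sq_eq_tsum]
  exact (summable_norm_sq ξ).tsum_le_tsum (fun a => by gcongr; exact h a) (summable_norm_sq η)

theorem memlp_mul_of_bounded {α : Type*} {f : α → ℂ} (hf : ∃ C, ∀ a, ‖f a‖ ≤ C) (ξ : Ell2 α) :
    Memℓp (fun a => f a * ξ a) 2 := by
  obtain ⟨C, hC⟩ := hf
  refine memℓp_gen ?_
  have h := (summable_norm_sq ξ).mul_left (C ^ 2)
  refine Summable.of_nonneg_of_le (fun a => by positivity) (fun a => ?_) h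
  have : ‖f a * ξ a‖ ≤ C * ‖ξ a‖ := by
    rw [norm_mul]
    gcongr
    exact hC a
  simp only [ENNReal.toReal_ofNat, Real.rpow_ofNat]
  calc ‖f a * ξ a‖ ^ 2 ≤ (C * ‖ξ a‖) ^ 2 := by gcongr
    _ = _ := by ring

/-- The operator of multiplication by a bounded function on `ℓ²(α)`. -/
def diagOp {α : Type*} (f : α → ℂ) (hf : ∃ C, ∀ a, ‖f a‖ ≤ C) : Ell2 α →L[ℂ] Ell2 α :=
  LinearMap.mkContinuousOfExistsBound
    { toFun := fun ξ => ⟨fun a => f a * ξ a, memlp_mul_of_bounded hf ξ⟩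
      map_add' := fun _ _ => lp.ext (funext fun _ => mul_add _ _ _)
      map_smul' := fun _ _ => lp.ext (funext fun _ => mul_left_comm _ _ _) }
    (by
      obtain ⟨C, hC⟩ := hf
      refine ⟨‖(C : ℂ)‖, fun ξ => ?_⟩
      rw [← norm_smul]
      refine norm_le_norm_of_forall fun a => ?_
      change ‖f a * ξ a‖ ≤ ‖(C : ℂ) * ξ a‖
      rw [norm_mul, norm_mul]
      gcongr
      exact (hC a).trans (by simpa using le_abs_self C))

@[simp]
theorem diagOp_apply {α : Type*} (f : α → ℂ) (hf : ∃ C, ∀ a, ‖f a‖ ≤ C) (ξ : Ell2 α) (a : α) :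
    diagOp f hf ξ a = f a * ξ a := rfl

theorem diagOp_delta {α : Type*} (f : α → ℂ) (hf : ∃ C, ∀ a, ‖f a‖ ≤ C) (a : α) :
    diagOp f hf (delta a) = f a • delta a := by
  refine Ell2.ext_inner fun b => ?_
  rw [diagOp_apply, lp.coeFn_smul, Pi.smul_apply, smul_eq_mul, delta_apply]
  split_ifs with h
  · rw [h]
  · simp

theorem norm_diagOp_le {α : Type*} (f : α → ℂ) (hf : ∃ C, ∀ a, ‖f a‖ ≤ C) {C : ℝ} (hC : 0 ≤ C)
    (h : ∀ a, ‖f a‖ ≤ C) : ‖diagOp f hf‖ ≤ C := by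
  refine ContinuousLinearMap.opNorm_le_bound _ hC fun ξ => ?_
  have : C * ‖ξ‖ = ‖(C : ℂ) • ξ‖ := by rw [norm_smul, Complex.norm_of_nonneg hC]
  rw [this]
  refine norm_le_norm_of_forall fun a => ?_
  change ‖f a * ξ a‖ ≤ ‖(C : ℂ) * ξ a‖
  rw [norm_mul, norm_mul, Complex.norm_of_nonneg hC]
  gcongr
  exact h a

theorem adjoint_diagOp {α : Type*} (f : α → ℂ) (hf : ∃ C, ∀ a, ‖f a‖ ≤ C)
    (hf' : ∃ C, ∀ a, ‖(starRingEnd ℂ) (f a)‖ ≤ C) :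
    ContinuousLinearMap.adjoint (diagOp f hf) = diagOp (fun a => (starRingEnd ℂ) (f a)) hf' := by
  refine clm_ext fun a => Ell2.ext_inner fun b => ?_
  rw [← inner_delta_left, ContinuousLinearMap.adjoint_inner_right, diagOp_delta, diagOp_delta,
    inner_smul_left, inner_delta_left, lp.coeFn_smul, Pi.smul_apply, smul_eq_mul, delta_apply]
  split_ifs with h
  · rw [h]
  · simp

/-- A uniformly bounded family of operators that converges on the standard basis converges
strongly. -/
theorem tendsto_of_tendsto_delta {α ι : Type*} {F : Type*} [NormedAddCommGroup F]
    [NormedSpace ℂ F] {l : Filter ι} {S : ι → Ell2 α →L[ℂ] F} {T : Ell2 α →L[ℂ] F} {C : ℝ}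
    (hC : ∀ᶠ i in l, ‖S i‖ ≤ C)
    (h : ∀ a, Filter.Tendsto (fun i => S i (delta a)) l (𝓝 (T (delta a)))) (ξ : Ell2 α) :
    Filter.Tendsto (fun i => S i ξ) l (𝓝 (T ξ)) := by
  rw [Metric.tendsto_nhds]
  intro ε hε
  set K : ℝ := |C| + ‖T‖ + 1 with hK
  have hKpos : 0 < K := by positivity
  have hs := (hasSum_delta ξ).eventually
    (Metric.ball_mem_nhds ξ (div_pos hε (mul_pos two_pos hKpos)))
  obtain ⟨s, hs⟩ := hs.exists
  set η : Ell2 α := ∑ a ∈ s, ξ a • delta a with hη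
  have hlim : Filter.Tendsto (fun i => S i η) l (𝓝 (T η)) := by
    simp only [hη, map_sum, map_smul]
    exact tendsto_finsetSum _ fun a _ => (h a).const_smul _
  have hlim' := (Metric.tendsto_nhds.1 hlim) (ε / 2) (half_pos hε)
  filter_upwards [hC, hlim'] with i hi hi'
  have hd : ‖ξ - η‖ < ε / (2 * K) := by
    rw [← dist_eq_norm, dist_comm]
    exact hs
  rw [dist_eq_norm] at hi' ⊢
  have e : S i ξ - T ξ = S i (ξ - η) - T (ξ - η) + (S i η - T η) := by
    simp only [map_sub]; abel
  have h1 : ‖S i (ξ - η) - T (ξ - η)‖ ≤ K * ‖ξ - η‖ := by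
    calc ‖S i (ξ - η) - T (ξ - η)‖ ≤ ‖S i (ξ - η)‖ + ‖T (ξ - η)‖ := norm_sub_le _ _
      _ ≤ ‖S i‖ * ‖ξ - η‖ + ‖T‖ * ‖ξ - η‖ :=
        add_le_add (ContinuousLinearMap.le_opNorm _ _) (ContinuousLinearMap.le_opNorm _ _)
      _ ≤ |C| * ‖ξ - η‖ + ‖T‖ * ‖ξ - η‖ := by
        gcongr
        exact hi.trans (le_abs_self C)
      _ ≤ K * ‖ξ - η‖ := by
        rw [hK]
        nlinarith [norm_nonneg (ξ - η)]
  have h2 : K * ‖ξ - η‖ < ε / 2 := by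
    calc K * ‖ξ - η‖ < K * (ε / (2 * K)) := by gcongr
      _ = ε / 2 := by field_simp
  calc ‖S i ξ - T ξ‖ ≤ ‖S i (ξ - η) - T (ξ - η)‖ + ‖S i η - T η‖ := by
        rw [e]; exact norm_add_le _ _
    _ < ε := by linarith

/-- A matrix whose finite sections are uniformly bounded defines a bounded operator. -/
theorem exists_clm_of_columns {α : Type*} (col : α → Ell2 α) {C : ℝ} (hC : 0 ≤ C)
    (h : ∀ y : α →₀ ℂ, ‖y.sum fun a c => c • col a‖
      ≤ C * ‖y.sum fun a c => c • (delta a : Ell2 α)‖) :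
    ∃ T : Ell2 α →L[ℂ] Ell2 α, (∀ a, T (delta a) = col a) ∧ ‖T‖ ≤ C := by
  let e : (α →₀ ℂ) →ₗ[ℂ] Ell2 α := Finsupp.linearCombination ℂ delta
  let f : (α →₀ ℂ) →ₗ[ℂ] Ell2 α := Finsupp.linearCombination ℂ col
  have hd : DenseRange e := by
    intro ξ
    refine mem_closure_of_tendsto (hasSum_delta ξ) (Filter.Eventually.of_forall fun s => ?_)
    change _ ∈ LinearMap.range e
    refine Submodule.sum_mem _ fun a _ => Submodule.smul_mem _ _ ⟨Finsupp.single a 1, ?_⟩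
    simp [e]
  refine ⟨f.extendOfNorm e, fun a => ?_, LinearMap.opNorm_extendOfNorm_le hd hC h⟩
  have := LinearMap.extendOfNorm_eq (f := f) (e := e) hd ⟨C, h⟩ (Finsupp.single a 1)
  simpa [e, f] using this

/-! ### The group von Neumann algebra as the commutant of the right translations -/

theorem rightTranslation_apply {Γ : Type*} [Group Γ] (g : Γ) (ξ : Ell2 Γ) (a : Γ) :
    rightTranslation g ξ a = ξ (a * g⁻¹) := by
  have h : (innerSL ℂ (delta a : Ell2 Γ)) ∘L rightTranslation g
      = innerSL ℂ (delta (a * g⁻¹) : Ell2 Γ) := by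
    refine clm_ext fun b => ?_
    simp only [ContinuousLinearMap.comp_apply, innerSL_apply_apply, rightTranslation_delta,
      inner_delta_left, delta_apply]
    classical exact if_congr mul_inv_eq_iff_eq_mul.symm rfl rfl
  have := congrArg (fun T => T ξ) h
  simpa [inner_delta_left] using this

theorem leftTranslation_apply {Γ : Type*} [Group Γ] (g : Γ) (ξ : Ell2 Γ) (a : Γ) :
    leftTranslation g ξ a = ξ (g⁻¹ * a) := by
  have h : (innerSL ℂ (delta a : Ell2 Γ)) ∘L leftTranslation g
      = innerSL ℂ (delta (g⁻¹ * a) : Ell2 Γ) := by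
    refine clm_ext fun b => ?_
    simp only [ContinuousLinearMap.comp_apply, innerSL_apply_apply, leftTranslation_delta,
      inner_delta_left, delta_apply]
    classical exact if_congr inv_mul_eq_iff_eq_mul.symm rfl rfl
  have := congrArg (fun T => T ξ) h
  simpa [inner_delta_left] using this

theorem star_leftTranslation {Γ : Type*} [Group Γ] (g : Γ) :
    star (leftTranslation g) = leftTranslation g⁻¹ := by
  refine clm_ext fun a => Ell2.ext_inner fun b => ?_
  rw [← inner_delta_left, ContinuousLinearMap.star_eq_adjoint,
    ContinuousLinearMap.adjoint_inner_right, leftTranslation_delta, leftTranslation_delta,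
    inner_delta_left, delta_apply, delta_apply]
  classical exact if_congr eq_inv_mul_iff_mul_eq.symm rfl rfl

theorem rightTranslation_mem_centralizer {Γ : Type*} [Group Γ] (g : Γ) :
    rightTranslation g ∈ StarSubalgebra.centralizer ℂ (Set.range (leftTranslation (Γ := Γ))) := by
  rw [StarSubalgebra.mem_centralizer_iff]
  rintro _ ⟨h, rfl⟩
  rw [star_leftTranslation]
  constructor <;> exact clm_ext fun a => by simp [mul_assoc]

theorem groupVN_rightTranslation {Γ : Type*} [Group Γ] (x : GroupVN Γ) (g : Γ) (ξ : Ell2 Γ) :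
    (x : Ell2 Γ →L[ℂ] Ell2 Γ) (rightTranslation g ξ)
      = rightTranslation g ((x : Ell2 Γ →L[ℂ] Ell2 Γ) ξ) := by
  have hx : (x : Ell2 Γ →L[ℂ] Ell2 Γ) ∈ StarSubalgebra.centralizer ℂ
      (StarSubalgebra.centralizer ℂ (Set.range (leftTranslation (Γ := Γ))) :
      Set (Ell2 Γ →L[ℂ] Ell2 Γ)) := x.2
  have h := ((StarSubalgebra.mem_centralizer_iff ℂ).1 hx _
    (rightTranslation_mem_centralizer g)).1
  exact (congrArg (fun T : Ell2 Γ →L[ℂ] Ell2 Γ => T ξ) h).symm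

/-- Since δ_g = ρ_g Ω and x commutes with ρ_g, the vector xΩ determines all columns of x. Hence Ω is
separating, and identities in 𝓛(Γ) can be checked in ℓ²(Γ). -/
theorem groupVN_delta {Γ : Type*} [Group Γ] (x : GroupVN Γ) (g : Γ) :
    (x : Ell2 Γ →L[ℂ] Ell2 Γ) (delta g) = rightTranslation g (toL2 x) := by
  change _ = rightTranslation g ((x : Ell2 Γ →L[ℂ] Ell2 Γ) (delta 1))
  rw [← groupVN_rightTranslation]
  simp

theorem groupVN_delta_apply {Γ : Type*} [Group Γ] (x : GroupVN Γ) (g h : Γ) :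
    (x : Ell2 Γ →L[ℂ] Ell2 Γ) (delta h) g = toL2 x (g * h⁻¹) := by
  rw [groupVN_delta, rightTranslation_apply]

theorem toL2_injective {Γ : Type*} [Group Γ] :
    Function.Injective (toL2 : GroupVN Γ →ₗ[ℂ] Ell2 Γ) := by
  intro x y h
  refine Subtype.ext (clm_ext fun a => ?_)
  rw [groupVN_delta, groupVN_delta, h]

theorem inner_eq_tsum {α : Type*} (ξ η : Ell2 α) :
    inner ℂ ξ η = ∑' a, (starRingEnd ℂ) (ξ a) * η a := by
  rw [lp.inner_eq_tsum]
  simp [mul_comm]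

/-- An operator that commutes with all right translations belongs to `𝓛(Γ)`. -/
theorem mem_groupVN_of_commute {Γ : Type*} [Group Γ] {T : Ell2 Γ →L[ℂ] Ell2 Γ}
    (hT : ∀ g h, T (delta (h * g)) = rightTranslation g (T (delta h))) :
    T ∈ (groupVN Γ).toStarSubalgebra := by
  have hTc : ∀ a b : Γ, T (delta b) a = T (delta 1) (a * b⁻¹) := by
    intro a b
    rw [← one_mul b, hT, rightTranslation_apply]
    simp
  have key : ∀ S ∈ StarSubalgebra.centralizer ℂ (Set.range (leftTranslation (Γ := Γ))),
      S * T = T * S := by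
    intro S hS
    have hSc : ∀ a b : Γ, S (delta b) a = S (delta 1) (b⁻¹ * a) := by
      intro a b
      have h := ((StarSubalgebra.mem_centralizer_iff ℂ).1 hS _ ⟨b, rfl⟩).1
      have h' := congrArg (fun R : Ell2 Γ →L[ℂ] Ell2 Γ => R (delta 1)) h
      simp only [mul_apply_eq_comp, leftTranslation_delta, mul_one] at h'
      rw [← h', leftTranslation_apply]
    refine clm_ext fun h => Ell2.ext_inner fun a => ?_
    have entry : ∀ R : Ell2 Γ →L[ℂ] Ell2 Γ, ∀ ξ : Ell2 Γ,
        R ξ a = ∑' b, R (delta b) a * ξ b := by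
      intro R ξ
      rw [← inner_delta_left, ← ContinuousLinearMap.adjoint_inner_left, inner_eq_tsum]
      refine tsum_congr fun b => ?_
      rw [← inner_delta_left b (ContinuousLinearMap.adjoint R (delta a)), inner_conj_symm,
        ContinuousLinearMap.adjoint_inner_left, inner_delta_left]
    rw [mul_apply_eq_comp, mul_apply_eq_comp, entry S, entry T]
    -- Both products are convolution sums: S has entries depending on b⁻¹a, T has entries depending
    -- on ab⁻¹. The substitution b ↦ ab⁻¹h exchanges them.
    let e : Γ ≃ Γ := (Equiv.inv Γ).trans ((Equiv.mulLeft a).trans (Equiv.mulRight h))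
    rw [← e.tsum_eq]
    refine tsum_congr fun b => ?_
    have he : e b = a * b⁻¹ * h := rfl
    rw [he, hSc a, hTc _ h, hTc a b, hSc b h, mul_comm]
    congr 2 <;> group
  change T ∈ StarSubalgebra.centralizer ℂ
    (StarSubalgebra.centralizer ℂ (Set.range (leftTranslation (Γ := Γ))) :
      Set (Ell2 Γ →L[ℂ] Ell2 Γ))
  rw [StarSubalgebra.mem_centralizer_iff]
  exact fun S hS => ⟨key S hS, key _ (star_mem hS)⟩

theorem trace_eq {Γ : Type*} [Group Γ] (x : GroupVN Γ) : trace x = toL2 x 1 :=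
  inner_delta_left _ _

theorem star_toL2_apply {Γ : Type*} [Group Γ] (x : GroupVN Γ) (g : Γ) :
    toL2 (star x) g = (starRingEnd ℂ) (toL2 x g⁻¹) := by
  have h : toL2 (star x) g = inner ℂ (delta g)
      (ContinuousLinearMap.adjoint (x : Ell2 Γ →L[ℂ] Ell2 Γ) (delta 1)) :=
    (inner_delta_left _ _).symm
  rw [h, ContinuousLinearMap.adjoint_inner_right, ← inner_conj_symm, inner_delta_left,
    groupVN_delta_apply, one_mul]

theorem trace_mul_eq_tsum {Γ : Type*} [Group Γ] (x y : GroupVN Γ) :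
    trace (x * y) = ∑' g, toL2 x g⁻¹ * toL2 y g := by
  have h : trace (x * y) = inner ℂ (toL2 (star x)) (toL2 y) :=
    (ContinuousLinearMap.adjoint_inner_left (x : Ell2 Γ →L[ℂ] Ell2 Γ) _ _).symm
  rw [h, inner_eq_tsum]
  simp [star_toL2_apply]

theorem toL2_groupUnitary {Γ : Type*} [Group Γ] (g : Γ) :
    toL2 (groupUnitary g : GroupVN Γ) = delta g := by
  change leftTranslation g (delta 1) = delta g
  simp

theorem toL2_one {Γ : Type*} [Group Γ] : toL2 (1 : GroupVN Γ) = delta 1 := rfl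

/-! ### Multipliers of positive definite functions -/

open scoped ComplexOrder in
/-- A positive definite function on a group. -/
def IsPosDefFun {Γ : Type*} [Group Γ] (f : Γ → ℂ) : Prop :=
  (Matrix.of fun g h : Γ => f (g * h⁻¹)).PosSemidef

/-- The vector `∑_{a ∈ F} z(a) δ_a`. -/
def sectionVec {α : Type*} (F : Finset α) (z : α → ℂ) : Ell2 α := ∑ a ∈ F, z a • delta a

theorem tendsto_sectionVec {α : Type*} (ξ : Ell2 α) :
    Filter.Tendsto (fun F => sectionVec F ξ) Filter.atTop (𝓝 ξ) := hasSum_delta ξ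

theorem norm_sq_sectionVec {α : Type*} (F : Finset α) (z : α → ℂ) :
    ‖sectionVec F z‖ ^ 2 = ∑ a ∈ F, ‖z a‖ ^ 2 := by
  have h := (orthonormal_delta α).inner_sum z z F
  have h2 : ((‖sectionVec F z‖ ^ 2 : ℝ) : ℂ) = ((∑ a ∈ F, ‖z a‖ ^ 2 : ℝ) : ℂ) := by
    have h3 : inner ℂ (sectionVec F z) (sectionVec F z) = ((‖sectionVec F z‖ : ℂ)) ^ 2 :=
      inner_self_eq_norm_sq_to_K (𝕜 := ℂ) _
    push_cast
    rw [← h3, sectionVec, h]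
    exact Finset.sum_congr rfl fun a _ => by rw [mul_comm, Complex.mul_conj']
  exact_mod_cast h2

theorem inner_sectionVec {α : Type*} (F : Finset α) (z y : α → ℂ) (T : Ell2 α →L[ℂ] Ell2 α) :
    inner ℂ (sectionVec F z) (T (sectionVec F y))
      = ∑ a ∈ F, ∑ b ∈ F, (starRingEnd ℂ) (z a) * y b * T (delta b) a := by
  simp only [sectionVec, sum_inner, map_sum, inner_sum, map_smul, inner_smul_left,
    inner_smul_right, inner_delta_left, Finset.mul_sum]
  rw [Finset.sum_comm]
  exact Finset.sum_congr rfl fun a _ => Finset.sum_congr rfl fun b _ => by ring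

open scoped ComplexOrder in
-- The section of the kernel f(gh⁻¹) over a finite set is a positive semidefinite matrix, hence a
-- sum of rank-one matrices; the v_k are the conjugates of the vectors involved, extended by zero.
theorem IsPosDefFun.exists_decomposition {Γ : Type*} [Group Γ] {f : Γ → ℂ} (hf : IsPosDefFun f)
    (F : Finset Γ) : ∃ (m : ℕ) (v : Fin m → Γ → ℂ), ∀ g ∈ F, ∀ h ∈ F,
      f (g * h⁻¹) = ∑ k, (starRingEnd ℂ) (v k g) * v k h := by
  classical
  obtain ⟨m, w, hw⟩ := Matrix.posSemidef_iff_eq_sum_vecMulVec.1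
    (hf.submatrix ((↑) : F → Γ))
  refine ⟨m, fun k g => if hg : g ∈ F then (starRingEnd ℂ) (w k ⟨g, hg⟩) else 0,
    fun g hg h hh => ?_⟩
  have := congrFun (congrFun hw ⟨g, hg⟩) ⟨h, hh⟩
  simp only [Matrix.submatrix_apply, Matrix.of_apply, Matrix.sum_apply,
    Matrix.vecMulVec_apply] at this
  rw [this]
  exact Finset.sum_congr rfl fun k _ => by simp [hg, hh]

section Multiplier

variable {Γ : Type*} [Group Γ] {f : Γ → ℂ}

/-- The finite sections of a positive definite multiplier are sums of compressions. -/
theorem IsPosDefFun.exists_compression (hf : IsPosDefFun f) (F : Finset Γ) :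
    ∃ (m : ℕ) (v : Fin m → Γ → ℂ),
      (∀ g ∈ F, f 1 = ∑ k, (starRingEnd ℂ) (v k g) * v k g) ∧
      ∀ (x : GroupVN Γ) (T : Γ → Ell2 Γ), (∀ g h, T h g = f (g * h⁻¹) * toL2 x (g * h⁻¹)) →
        ∀ z y : Γ → ℂ, inner ℂ (sectionVec F z) (∑ h ∈ F, y h • T h)
          = ∑ k, inner ℂ (sectionVec F fun g => v k g * z g)
            ((x : Ell2 Γ →L[ℂ] Ell2 Γ) (sectionVec F fun g => v k g * y g)) := by
  obtain ⟨m, v, hv⟩ := hf.exists_decomposition F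
  refine ⟨m, v, fun g hg => by simpa using hv g hg g hg, fun x T hT z y => ?_⟩
  simp only [inner_sectionVec, groupVN_delta_apply]
  simp only [sectionVec, sum_inner, inner_sum, inner_smul_left, inner_smul_right,
    inner_delta_left, hT, Finset.mul_sum]
  rw [Finset.sum_comm, Finset.sum_comm (s := Finset.univ)]
  refine Finset.sum_congr rfl fun g hg => ?_
  rw [Finset.sum_comm (s := Finset.univ)]
  refine Finset.sum_congr rfl fun h hh => ?_
  rw [hv g hg h hh, Finset.sum_mul, Finset.mul_sum, Finset.mul_sum]
  refine Finset.sum_congr rfl fun k _ => ?_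
  rw [map_mul]
  ring

/-- The diagonal case of the Gram factorization reads ∑_k |v_k(g)|² = f(1) = 1 on F: multiplication
by the v_k is a column isometry on vectors supported in F. -/
theorem IsPosDefFun.sum_norm_sq (F : Finset Γ) {m : ℕ} {v : Fin m → Γ → ℂ} (h1 : f 1 = 1)
    (hv : ∀ g ∈ F, f 1 = ∑ k, (starRingEnd ℂ) (v k g) * v k g) (z : Γ → ℂ) :
    ∑ k, ‖sectionVec F fun g => v k g * z g‖ ^ 2 = ‖sectionVec F z‖ ^ 2 := by
  simp only [norm_sq_sectionVec]
  rw [Finset.sum_comm]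
  refine Finset.sum_congr rfl fun g hg => ?_
  have h : ∑ k, ‖v k g‖ ^ 2 = 1 := by
    have h2 := hv g hg
    rw [h1] at h2
    have h3 : ((∑ k, ‖v k g‖ ^ 2 : ℝ) : ℂ) = 1 := by
      rw [h2]
      push_cast
      exact Finset.sum_congr rfl fun k _ => by rw [mul_comm, Complex.mul_conj']
    exact_mod_cast h3
  simp only [norm_mul, mul_pow]
  rw [← Finset.sum_mul, h, one_mul]

/-- T is the Schur product of x with the kernel f(gh⁻¹), given by its columns ρ_h(f · xΩ). Each
finite section is ∑_k V_k* x V_k with V_k multiplication by v_k, and ∑_k V_k* V_k = 1 bounds its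
norm by ‖x‖. -/
theorem IsPosDefFun.exists_multiplier (hf : IsPosDefFun f) (h1 : f 1 = 1)
    (hb : ∃ C, ∀ g, ‖f g‖ ≤ C) (x : GroupVN Γ) :
    ∃ T : GroupVN Γ, toL2 T = diagOp f hb (toL2 x) ∧
      ‖(T : Ell2 Γ →L[ℂ] Ell2 Γ)‖ ≤ ‖(x : Ell2 Γ →L[ℂ] Ell2 Γ)‖ := by
  classical
  set col : Γ → Ell2 Γ := fun h => rightTranslation h (diagOp f hb (toL2 x)) with hcol
  have hcolapp : ∀ g h, col h g = f (g * h⁻¹) * toL2 x (g * h⁻¹) := fun g h => by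
    rw [hcol, rightTranslation_apply, diagOp_apply]
  set C := ‖(x : Ell2 Γ →L[ℂ] Ell2 Γ)‖ with hC
  have bound : ∀ (F : Finset Γ) (z y : Γ → ℂ),
      ‖inner ℂ (sectionVec F z) (∑ h ∈ F, y h • col h)‖
        ≤ C * (‖sectionVec F z‖ * ‖sectionVec F y‖) := by
    intro F z y
    obtain ⟨m, v, hv1, hv⟩ := hf.exists_compression F
    rw [hv x col hcolapp z y]
    calc _ ≤ ∑ k, ‖inner ℂ (sectionVec F fun g => v k g * z g)
            ((x : Ell2 Γ →L[ℂ] Ell2 Γ) (sectionVec F fun g => v k g * y g))‖ := norm_sum_le _ _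
      _ ≤ ∑ k, C * (‖sectionVec F fun g => v k g * z g‖ * ‖sectionVec F fun g => v k g * y g‖) := by
        refine Finset.sum_le_sum fun k _ => (norm_inner_le_norm _ _).trans ?_
        calc _ ≤ ‖sectionVec F fun g => v k g * z g‖ * (C * ‖sectionVec F fun g => v k g * y g‖) := by
              gcongr
              exact ContinuousLinearMap.le_opNorm _ _
          _ = _ := by ring
      _ = C * ∑ k, ‖sectionVec F fun g => v k g * z g‖ * ‖sectionVec F fun g => v k g * y g‖ := by
        rw [Finset.mul_sum]
      _ ≤ C * (‖sectionVec F z‖ * ‖sectionVec F y‖) := by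
        gcongr
        refine abs_le_of_sq_le_sq' ?_ (by positivity) |>.2
        refine (Finset.sum_mul_sq_le_sq_mul_sq _ _ _).trans ?_
        rw [IsPosDefFun.sum_norm_sq F h1 hv1, IsPosDefFun.sum_norm_sq F h1 hv1, mul_pow]
  obtain ⟨T, hT, hTn⟩ := exists_clm_of_columns col (norm_nonneg (x : Ell2 Γ →L[ℂ] Ell2 Γ)) (by
    intro y
    set u : Ell2 Γ := y.sum fun a c => c • col a with hu
    have hlim : Filter.Tendsto (fun F => ‖sectionVec F u‖) Filter.atTop (𝓝 ‖u‖) :=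
      (tendsto_sectionVec u).norm
    refine le_of_tendsto hlim ?_
    filter_upwards [Filter.eventually_ge_atTop y.support] with F hF
    have hu' : u = ∑ h ∈ F, y h • col h :=
      Finset.sum_subset hF fun a _ ha => by simp [Finsupp.notMem_support_iff.1 ha]
    have hy' : (y.sum fun a c => c • (delta a : Ell2 Γ)) = sectionVec F y :=
      Finset.sum_subset hF fun a _ ha => by simp [Finsupp.notMem_support_iff.1 ha]
    rw [hy']
    have hb := bound F u y
    rw [← hu'] at hb
    -- Testing u against its own truncation to F gives ‖u_F‖² ≤ C ‖u_F‖ ‖y‖; after dividing by ‖u_F‖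
    -- the bound survives the limit over F.
    have e : inner ℂ (sectionVec F u) u = ((‖sectionVec F u‖ ^ 2 : ℝ) : ℂ) := by
      rw [norm_sq_sectionVec]
      simp only [sectionVec, sum_inner, inner_smul_left, inner_delta_left]
      push_cast
      exact Finset.sum_congr rfl fun a _ => by rw [mul_comm, Complex.mul_conj']
    rw [e, Complex.norm_of_nonneg (by positivity)] at hb
    by_cases h0 : ‖sectionVec F u‖ = 0
    · rw [h0]; positivity
    · have hpos : 0 < ‖sectionVec F u‖ := lt_of_le_of_ne (norm_nonneg _) (Ne.symm h0)
      refine le_of_mul_le_mul_left ?_ hpos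
      calc _ = ‖sectionVec F u‖ ^ 2 := by ring
        _ ≤ _ := hb
        _ = _ := by ring)
  refine ⟨⟨T, mem_groupVN_of_commute fun g h => ?_⟩, ?_, hTn⟩
  · rw [hT, hT, hcol]
    refine Ell2.ext_inner fun a => ?_
    simp [rightTranslation_apply, mul_assoc]
  · change T (delta 1) = _
    rw [hT, hcol]
    refine Ell2.ext_inner fun a => ?_
    simp [rightTranslation_apply]

/-- The Fourier multiplier `u_g ↦ f(g) u_g` on `𝓛(Γ)` of a normalized positive definite
function. -/
def multiplier (hf : IsPosDefFun f) (h1 : f 1 = 1) (hb : ∃ C, ∀ g, ‖f g‖ ≤ C) :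
    GroupVN Γ →ₗ[ℂ] GroupVN Γ where
  toFun x := (hf.exists_multiplier h1 hb x).choose
  map_add' x y := toL2_injective (by
    rw [(hf.exists_multiplier h1 hb (x + y)).choose_spec.1, map_add, map_add, map_add,
      (hf.exists_multiplier h1 hb x).choose_spec.1, (hf.exists_multiplier h1 hb y).choose_spec.1])
  map_smul' c x := toL2_injective (by
    rw [(hf.exists_multiplier h1 hb (c • x)).choose_spec.1, map_smul, map_smul, map_smul,
      (hf.exists_multiplier h1 hb x).choose_spec.1, RingHom.id_apply])

theorem toL2_multiplier (hf : IsPosDefFun f) (h1 : f 1 = 1) (hb : ∃ C, ∀ g, ‖f g‖ ≤ C)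
    (x : GroupVN Γ) : toL2 (multiplier hf h1 hb x) = diagOp f hb (toL2 x) :=
  (hf.exists_multiplier h1 hb x).choose_spec.1

theorem norm_multiplier_le (hf : IsPosDefFun f) (h1 : f 1 = 1) (hb : ∃ C, ∀ g, ‖f g‖ ≤ C)
    (x : GroupVN Γ) :
    ‖(multiplier hf h1 hb x : Ell2 Γ →L[ℂ] Ell2 Γ)‖ ≤ ‖(x : Ell2 Γ →L[ℂ] Ell2 Γ)‖ :=
  (hf.exists_multiplier h1 hb x).choose_spec.2

open scoped ComplexOrder in
-- On finitely supported vectors the amplified quadratic form is ∑_k of the form of x at the vectors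
-- v_k ξ_i, with the same v_k for all matrix entries. Each summand is nonnegative, and truncations
-- converge.
theorem isCompletelyPositive_multiplier (hf : IsPosDefFun f) (h1 : f 1 = 1)
    (hb : ∃ C, ∀ g, ‖f g‖ ≤ C) : IsCompletelyPositive (multiplier hf h1 hb) := by
  intro n x hx ξ
  have hlim : Filter.Tendsto (fun F => ∑ i, ∑ j, inner ℂ (sectionVec F (ξ i))
      ((multiplier hf h1 hb (x i j) : Ell2 Γ →L[ℂ] Ell2 Γ) (sectionVec F (ξ j))))
      Filter.atTop (𝓝 (∑ i, ∑ j, inner ℂ (ξ i)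
        ((multiplier hf h1 hb (x i j) : Ell2 Γ →L[ℂ] Ell2 Γ) (ξ j)))) := by
    refine tendsto_finsetSum _ fun i _ => tendsto_finsetSum _ fun j _ => ?_
    exact (tendsto_sectionVec (ξ i)).inner
      (((ContinuousLinearMap.continuous _).tendsto _).comp (tendsto_sectionVec (ξ j)))
  refine ge_of_tendsto hlim (Filter.Eventually.of_forall fun F => ?_)
  obtain ⟨m, v, -, hv⟩ := hf.exists_compression F
  have key : ∀ i j, inner ℂ (sectionVec F (ξ i))
      ((multiplier hf h1 hb (x i j) : Ell2 Γ →L[ℂ] Ell2 Γ) (sectionVec F (ξ j)))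
      = ∑ k, inner ℂ (sectionVec F fun g => v k g * ξ i g)
            ((x i j : Ell2 Γ →L[ℂ] Ell2 Γ) (sectionVec F fun g => v k g * ξ j g)) := by
    intro i j
    rw [← hv (x i j) (fun h => (multiplier hf h1 hb (x i j) : Ell2 Γ →L[ℂ] Ell2 Γ) (delta h))
      (fun g h => by rw [groupVN_delta_apply, toL2_multiplier, diagOp_apply])]
    simp [sectionVec, map_sum]
  simp only [key]
  have hswap : ∀ c : Fin n → Fin n → Fin m → ℂ,
      ∑ i, ∑ j, ∑ k, c i j k = ∑ k, ∑ i, ∑ j, c i j k := by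
    intro c
    rw [Finset.sum_comm]
    simp_rw [Finset.sum_comm (s := (Finset.univ : Finset (Fin n)))
      (t := (Finset.univ : Finset (Fin m)))]
    refine Finset.sum_congr rfl fun k _ => Finset.sum_comm
  rw [hswap]
  exact Finset.sum_nonneg fun k _ => hx fun i => sectionVec F fun g => v k g * ξ i g

end Multiplier

/-! ### The group algebra in `ℓ²(Γ)` -/

theorem ofGroupAlgebra_of {Γ : Type*} [Group Γ] (g : Γ) :
    ofGroupAlgebra (MonoidAlgebra.of ℂ Γ g) = groupUnitary g := by
  simp [ofGroupAlgebra]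

theorem vec_of {Γ : Type*} [Group Γ] (g : Γ) : vec (MonoidAlgebra.of ℂ Γ g) = delta g := by
  change toL2 (ofGroupAlgebra (MonoidAlgebra.of ℂ Γ g)) = _
  rw [ofGroupAlgebra_of, toL2_groupUnitary]

theorem leftAct_of {Γ : Type*} [Group Γ] (g : Γ) :
    leftAct (MonoidAlgebra.of ℂ Γ g) = leftTranslation g := by
  unfold leftAct
  rw [ofGroupAlgebra_of]
  rfl

theorem rightAct_of {Γ : Type*} [Group Γ] (g : Γ) :
    rightAct (MonoidAlgebra.of ℂ Γ g) = rightTranslation g := by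
  simp [rightAct]

theorem leftAct_add {Γ : Type*} [Group Γ] (a b : MonoidAlgebra ℂ Γ) :
    leftAct (a + b) = leftAct a + leftAct b := by
  simp [leftAct]

theorem leftAct_smul {Γ : Type*} [Group Γ] (c : ℂ) (a : MonoidAlgebra ℂ Γ) :
    leftAct (c • a) = c • leftAct a := by
  simp [leftAct]

theorem rightAct_add {Γ : Type*} [Group Γ] (a b : MonoidAlgebra ℂ Γ) :
    rightAct (a + b) = rightAct a + rightAct b := by
  classical
  unfold rightAct
  rw [MonoidAlgebra.coeff_add]
  exact Finsupp.sum_add_index' (by simp) (by simp [add_smul])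

theorem rightAct_smul {Γ : Type*} [Group Γ] (c : ℂ) (a : MonoidAlgebra ℂ Γ) :
    rightAct (c • a) = c • rightAct a := by
  unfold rightAct
  rw [MonoidAlgebra.coeff_smul, Finsupp.sum_smul_index' (by simp), Finsupp.smul_sum]
  simp [smul_smul]

/-! ### Generators -/

theorem QMS.mem_graph_generator_iff {Γ : Type*} [Group Γ] (Φ : QMS Γ) (ξ η : Ell2 Γ) :
    (ξ, η) ∈ Φ.generator.graph ↔
      Filter.Tendsto (fun t : ℝ≥0 => ((t : ℝ) : ℂ)⁻¹ • (ξ - Φ.l2 t ξ)) (𝓝[>] 0) (𝓝 η) := by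
  rw [LinearPMap.mem_graph_iff]
  constructor
  · rintro ⟨y, rfl, rfl⟩
    exact y.2.choose_spec
  · intro h
    exact ⟨⟨ξ, η, h⟩, rfl, tendsto_nhds_unique (Exists.choose_spec (⟨η, h⟩ : ∃ η, Filter.Tendsto
      (fun t : ℝ≥0 => ((t : ℝ) : ℂ)⁻¹ • (ξ - Φ.l2 t ξ)) (𝓝[>] 0) (𝓝 η))) h⟩

/-! ### Semigroups of Fourier multipliers -/

/-- A symmetric nonnegative function `ψ` with `ψ(1) = 0` on a group such that all `exp(-tψ)` are
positive definite. -/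
structure IsNegDefFun {Γ : Type*} [Group Γ] (ψ : Γ → ℝ) : Prop where
  nonneg : ∀ g, 0 ≤ ψ g
  one : ψ 1 = 0
  inv : ∀ g, ψ g⁻¹ = ψ g
  exp : ∀ t : ℝ≥0, IsPosDefFun fun g => ((Real.exp (-(t * ψ g)) : ℝ) : ℂ)

section MultiplierSemigroup

variable {Γ : Type*} [Group Γ] {ψ : Γ → ℝ}

theorem IsNegDefFun.norm_exp_le (hψ : IsNegDefFun ψ) (t : ℝ≥0) (g : Γ) :
    ‖((Real.exp (-(t * ψ g)) : ℝ) : ℂ)‖ ≤ 1 := by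
  rw [Complex.norm_of_nonneg (Real.exp_pos _).le, Real.exp_le_one_iff]
  have := hψ.nonneg g
  have := t.2
  simp only [Left.neg_nonpos_iff]
  positivity

theorem IsNegDefFun.bounded_exp (hψ : IsNegDefFun ψ) (t : ℝ≥0) :
    ∃ C, ∀ g, ‖((Real.exp (-(t * ψ g)) : ℝ) : ℂ)‖ ≤ C := ⟨1, hψ.norm_exp_le t⟩

/-- The map `exp(-tψ)` on `𝓛(Γ)`. -/
def IsNegDefFun.map (hψ : IsNegDefFun ψ) (t : ℝ≥0) : GroupVN Γ →ₗ[ℂ] GroupVN Γ :=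
  multiplier (hψ.exp t) (by simp [hψ.one]) (hψ.bounded_exp t)

/-- Multiplication by `exp(-tψ)` on `ℓ²(Γ)`. -/
def IsNegDefFun.expOp (hψ : IsNegDefFun ψ) (t : ℝ≥0) : Ell2 Γ →L[ℂ] Ell2 Γ :=
  diagOp _ (hψ.bounded_exp t)

theorem IsNegDefFun.toL2_map (hψ : IsNegDefFun ψ) (t : ℝ≥0) (x : GroupVN Γ) :
    toL2 (hψ.map t x) = hψ.expOp t (toL2 x) := toL2_multiplier _ _ _ _

theorem IsNegDefFun.expOp_apply (hψ : IsNegDefFun ψ) (t : ℝ≥0) (ξ : Ell2 Γ) (g : Γ) :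
    hψ.expOp t ξ g = ((Real.exp (-(t * ψ g)) : ℝ) : ℂ) * ξ g := rfl

theorem IsNegDefFun.continuous_expOp (hψ : IsNegDefFun ψ) (ξ : Ell2 Γ) :
    Continuous fun t => hψ.expOp t ξ := by
  refine continuous_iff_continuousAt.2 fun t => tendsto_of_tendsto_delta (C := 1)
    (Filter.Eventually.of_forall fun s => norm_diagOp_le _ _ zero_le_one (hψ.norm_exp_le s))
    (fun g => ?_) ξ
  simp only [IsNegDefFun.expOp, diagOp_delta]
  have : Continuous fun s : ℝ≥0 => ((Real.exp (-(s * ψ g)) : ℝ) : ℂ) • (delta g : Ell2 Γ) := by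
    fun_prop
  exact this.tendsto t

/-- The quantum Markov semigroup of the Fourier multipliers `exp(-tψ)`. -/
def IsNegDefFun.semigroup (hψ : IsNegDefFun ψ) : QMS Γ where
  toFun := hψ.map
  map_zero := by
    refine LinearMap.ext fun x => toL2_injective (Ell2.ext_inner fun g => ?_)
    rw [hψ.toL2_map, hψ.expOp_apply]
    simp
  map_add s t := by
    refine LinearMap.ext fun x => toL2_injective (Ell2.ext_inner fun g => ?_)
    rw [LinearMap.comp_apply, hψ.toL2_map, hψ.toL2_map, hψ.toL2_map, hψ.expOp_apply,
      hψ.expOp_apply, hψ.expOp_apply, ← mul_assoc, ← Complex.ofReal_mul, ← Real.exp_add]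
    congr 3
    push_cast
    ring_nf
  map_one t := by
    refine toL2_injective ?_
    rw [hψ.toL2_map, toL2_one, IsNegDefFun.expOp, diagOp_delta]
    simp [hψ.one]
  completelyPositive t := isCompletelyPositive_multiplier _ _ _
  trace_map t x := by
    rw [trace_eq, trace_eq, hψ.toL2_map, hψ.expOp_apply]
    simp [hψ.one]
  symmetric t x y := by
    rw [trace_mul_eq_tsum, trace_mul_eq_tsum]
    refine tsum_congr fun g => ?_
    rw [hψ.toL2_map, hψ.toL2_map, hψ.expOp_apply, hψ.expOp_apply, hψ.inv]
    ring
  continuous x ξ := by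
    refine continuous_iff_continuousAt.2 fun t => tendsto_of_tendsto_delta
      (C := ‖(x : Ell2 Γ →L[ℂ] Ell2 Γ)‖)
      (Filter.Eventually.of_forall fun s => norm_multiplier_le _ _ _ x) (fun g => ?_) ξ
    -- On basis vectors the orbit is ρ_g applied to the norm-continuous orbit exp(-sψ)xΩ; the
    -- uniform bound ‖x‖ carries continuity over to all vectors.
    have h : ∀ s, (hψ.map s x : Ell2 Γ →L[ℂ] Ell2 Γ) (delta g)
        = rightTranslation g (hψ.expOp s (toL2 x)) := fun s => by
      rw [groupVN_delta, hψ.toL2_map]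
    exact (((rightTranslation g).continuous.comp (hψ.continuous_expOp (toL2 x))).congr
      fun s => (h s).symm).tendsto t

theorem IsNegDefFun.semigroup_toFun (hψ : IsNegDefFun ψ) (t : ℝ≥0) :
    hψ.semigroup.toFun t = hψ.map t := rfl

theorem IsNegDefFun.semigroup_groupUnitary (hψ : IsNegDefFun ψ) (t : ℝ≥0) (g : Γ) :
    hψ.semigroup.toFun t (groupUnitary g)
      = ((Real.exp (-(t * ψ g)) : ℝ) : ℂ) • groupUnitary g := by
  refine toL2_injective ?_
  rw [hψ.semigroup_toFun, hψ.toL2_map, map_smul, toL2_groupUnitary, IsNegDefFun.expOp,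
    diagOp_delta]

theorem IsNegDefFun.semigroup_l2 (hψ : IsNegDefFun ψ) (t : ℝ≥0) :
    hψ.semigroup.l2 t = hψ.expOp t := by
  refine clm_ext fun g => ?_
  rw [← toL2_groupUnitary, QMS.l2_toL2, hψ.semigroup_toFun, hψ.toL2_map]

theorem tendsto_coe_nhdsGT_zero :
    Filter.Tendsto (fun t : ℝ≥0 => (t : ℝ)) (𝓝[>] 0) (𝓝[>] 0) := by
  refine tendsto_nhdsWithin_iff.2 ⟨?_, ?_⟩
  · exact (NNReal.continuous_coe.tendsto 0).mono_left nhdsWithin_le_nhds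
  · filter_upwards [self_mem_nhdsWithin] with t ht
    exact NNReal.coe_pos.2 ht

/-- This is the derivative of -exp(-tc) at t = 0. -/
theorem tendsto_inv_mul_one_sub_exp (c : ℝ) :
    Filter.Tendsto (fun t : ℝ≥0 => ((t : ℝ) : ℂ)⁻¹ * (1 - ((Real.exp (-(t * c)) : ℝ) : ℂ)))
      (𝓝[>] 0) (𝓝 (c : ℂ)) := by
  have h : HasDerivAt (fun t : ℝ => -Real.exp (-(t * c))) c 0 := by
    have := (((hasDerivAt_id (0 : ℝ)).mul_const c).neg.exp).neg
    convert! this using 1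
    simp
  have h2 := h.tendsto_slope_zero_right.comp tendsto_coe_nhdsGT_zero
  have h3 := (Complex.continuous_ofReal.tendsto c).comp h2
  refine h3.congr fun t => ?_
  simp
  left
  ring

/-- The generator is the maximal multiplication operator by ψ. Coordinatewise limits force η = ψξ;
conversely, if ψξ lies in ℓ², the difference quotients are bounded multipliers applied to ψξ and
converge by domination. -/
theorem IsNegDefFun.mem_graph_generator_iff (hψ : IsNegDefFun ψ) (ξ η : Ell2 Γ) :
    (ξ, η) ∈ hψ.semigroup.generator.graph ↔ ∀ g, η g = ψ g * ξ g := by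
  rw [QMS.mem_graph_generator_iff]
  simp only [hψ.semigroup_l2]
  constructor
  · intro h g
    have h1 := ((innerSL ℂ (delta g : Ell2 Γ)).continuous.tendsto _).comp h
    simp only [Function.comp_def, innerSL_apply_apply, inner_delta_left] at h1
    refine tendsto_nhds_unique h1 (((tendsto_inv_mul_one_sub_exp (ψ g)).mul_const (ξ g)).congr
      fun t => ?_)
    rw [lp.coeFn_smul, Pi.smul_apply, lp.coeFn_sub, Pi.sub_apply, hψ.expOp_apply, smul_eq_mul]
    ring
  · intro h
    -- q_t = (1 - exp(-tψ))/(tψ) is at most 1 because 1 - exp(-x) ≤ x. Where ψ = 0 the convention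
    -- 0⁻¹ = 0 makes q_t vanish, which is harmless since η = ψξ vanishes there too.
    set q : ℝ≥0 → Γ → ℂ := fun t g =>
      ((t : ℝ) : ℂ)⁻¹ * (1 - ((Real.exp (-(t * ψ g)) : ℝ) : ℂ)) * (ψ g : ℂ)⁻¹ with hq
    have hq1 : ∀ t g, ‖q t g‖ ≤ 1 := by
      intro t g
      have e : q t g = (((t : ℝ)⁻¹ * (1 - Real.exp (-(t * ψ g))) * (ψ g)⁻¹ : ℝ) : ℂ) := by
        rw [hq]; push_cast; rfl
      have h0 := hψ.nonneg g
      have ht := t.2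
      have hx : 0 ≤ (t : ℝ) * ψ g := mul_nonneg ht h0
      have h1 : 0 ≤ 1 - Real.exp (-(t * ψ g)) := by
        rw [sub_nonneg, Real.exp_le_one_iff]; linarith
      have h2 : 1 - Real.exp (-(t * ψ g)) ≤ t * ψ g := by
        linarith [Real.add_one_le_exp (-(t * ψ g))]
      rw [e, Complex.norm_of_nonneg (by positivity)]
      calc (t : ℝ)⁻¹ * (1 - Real.exp (-(t * ψ g))) * (ψ g)⁻¹
          ≤ (t : ℝ)⁻¹ * (t * ψ g) * (ψ g)⁻¹ := by gcongr
        _ = ((t : ℝ)⁻¹ * t) * (ψ g * (ψ g)⁻¹) := by ring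
        _ ≤ 1 * 1 := by
          gcongr
          · exact inv_mul_le_one
          · exact mul_inv_le_one
        _ = 1 := one_mul 1
    have hb : ∀ t, ∃ C, ∀ g, ‖q t g‖ ≤ C := fun t => ⟨1, hq1 t⟩
    have hb' : ∃ C, ∀ g, ‖(ψ g : ℂ) * (ψ g : ℂ)⁻¹‖ ≤ C := by
      refine ⟨1, fun g => ?_⟩
      rw [norm_mul, norm_inv]
      exact mul_inv_le_one
    have hlim := tendsto_of_tendsto_delta (S := fun t => diagOp (q t) (hb t))
      (T := diagOp _ hb') (l := 𝓝[>] (0 : ℝ≥0)) (C := 1)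
      (Filter.Eventually.of_forall fun t => norm_diagOp_le _ _ zero_le_one (hq1 t))
      (fun g => by
        simp only [diagOp_delta]
        exact ((tendsto_inv_mul_one_sub_exp (ψ g)).mul_const _).smul_const _) η
    have hη : diagOp _ hb' η = η := by
      refine Ell2.ext_inner fun g => ?_
      rw [diagOp_apply, h]
      by_cases h0 : (ψ g : ℂ) = 0
      · simp [h0]
      · field_simp
    rw [hη] at hlim
    refine hlim.congr fun t => Ell2.ext_inner fun g => ?_
    rw [diagOp_apply, lp.coeFn_smul, Pi.smul_apply, lp.coeFn_sub, Pi.sub_apply, hψ.expOp_apply,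
      smul_eq_mul, h, hq]
    by_cases h0 : (ψ g : ℂ) = 0
    · have h0' : ψ g = 0 := by exact_mod_cast h0
      simp [h0']
    · field_simp

theorem IsNegDefFun.delta_mem_graph (hψ : IsNegDefFun ψ) (g : Γ) :
    ((delta g : Ell2 Γ), (ψ g : ℂ) • (delta g : Ell2 Γ)) ∈ hψ.semigroup.generator.graph := by
  rw [hψ.mem_graph_generator_iff]
  intro h
  rw [lp.coeFn_smul, Pi.smul_apply, smul_eq_mul, delta_apply]
  split_ifs with e
  · rw [e]
  · simp

theorem IsNegDefFun.vec_mem_domain (hψ : IsNegDefFun ψ) (x : MonoidAlgebra ℂ Γ) :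
    vec x ∈ hψ.semigroup.generator.domain := by
  induction x using MonoidAlgebra.induction_on with
  | of g =>
    rw [vec_of]
    exact LinearPMap.mem_domain_of_mem_graph (hψ.delta_mem_graph g)
  | add x y hx hy =>
    rw [map_add]
    exact Submodule.add_mem _ hx hy
  | smul c x hx =>
    rw [map_smul]
    exact Submodule.smul_mem _ c hx

/-- The graph is cut out by one closed condition per coordinate. -/
theorem IsNegDefFun.isClosed_generator (hψ : IsNegDefFun ψ) :
    hψ.semigroup.generator.IsClosed := by
  have h : (hψ.semigroup.generator.graph : Set (Ell2 Γ × Ell2 Γ))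
      = ⋂ g, {z | innerSL ℂ (delta g : Ell2 Γ) z.2 = ψ g * innerSL ℂ (delta g : Ell2 Γ) z.1} := by
    ext ⟨ξ, η⟩
    simp only [SetLike.mem_coe, hψ.mem_graph_generator_iff, Set.mem_iInter, Set.mem_ofPred_eq,
      innerSL_apply_apply, inner_delta_left]
  unfold LinearPMap.IsClosed
  rw [h]
  refine isClosed_iInter fun g => isClosed_eq ?_ ?_
  · fun_prop
  · fun_prop

/-- The restriction of the generator of the multiplier semigroup `exp(-tψ)` to `ℂ[Γ] Ω`. -/
def IsNegDefFun.pregenerator (hψ : IsNegDefFun ψ) : Ell2 Γ →ₗ.[ℂ] Ell2 Γ :=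
  hψ.semigroup.generator.domRestrict (LinearMap.range (vec (Γ := Γ)))

theorem IsNegDefFun.pregenerator_domain (hψ : IsNegDefFun ψ) :
    hψ.pregenerator.domain = LinearMap.range (vec (Γ := Γ)) := by
  rw [IsNegDefFun.pregenerator, LinearPMap.domRestrict_domain, inf_eq_left]
  rintro _ ⟨x, rfl⟩
  exact hψ.vec_mem_domain x

theorem IsNegDefFun.pregenerator_le (hψ : IsNegDefFun ψ) :
    hψ.pregenerator ≤ hψ.semigroup.generator := LinearPMap.domRestrict_le

theorem IsNegDefFun.isClosable_pregenerator (hψ : IsNegDefFun ψ) :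
    hψ.pregenerator.IsClosable :=
  hψ.isClosed_generator.isClosable.leIsClosable hψ.pregenerator_le

theorem IsNegDefFun.pregenerator_delta (hψ : IsNegDefFun ψ) (g : Γ)
    (hg : delta g ∈ hψ.pregenerator.domain) :
    hψ.pregenerator ⟨delta g, hg⟩ = (ψ g : ℂ) • delta g :=
  LinearPMap.mem_graph_snd_inj _
    (LinearPMap.le_graph_of_le hψ.pregenerator_le (LinearPMap.mem_graph _ ⟨delta g, hg⟩))
    (hψ.delta_mem_graph g) rfl

theorem IsNegDefFun.delta_mem_graph_pregenerator (hψ : IsNegDefFun ψ) (g : Γ) :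
    ((delta g : Ell2 Γ), (ψ g : ℂ) • (delta g : Ell2 Γ)) ∈ hψ.pregenerator.graph := by
  have hg : delta g ∈ hψ.pregenerator.domain := by
    rw [hψ.pregenerator_domain]
    exact ⟨_, vec_of g⟩
  rw [← hψ.pregenerator_delta g hg]
  exact LinearPMap.mem_graph _ ⟨delta g, hg⟩

/-- Finitely supported vectors form a core: truncating ξ to a finite set also truncates η = ψξ, so
the truncated pairs converge to (ξ, η) in the graph. -/
theorem IsNegDefFun.generator_eq_closure (hψ : IsNegDefFun ψ) :
    hψ.semigroup.generator = hψ.pregenerator.closure := by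
  refine LinearPMap.eq_of_eq_graph ?_
  rw [← hψ.isClosable_pregenerator.graph_closure_eq_closure_graph]
  refine le_antisymm ?_ (Submodule.topologicalClosure_minimal _
    (LinearPMap.le_graph_of_le hψ.pregenerator_le) hψ.isClosed_generator)
  rintro ⟨ξ, η⟩ h
  rw [hψ.mem_graph_generator_iff] at h
  have hlim : Filter.Tendsto
      (fun s : Finset Γ => ∑ g ∈ s, ξ g • ((delta g : Ell2 Γ), (ψ g : ℂ) • (delta g : Ell2 Γ)))
      Filter.atTop (𝓝 (ξ, η)) := by
    have h2 := (hasSum_delta ξ).prodMk (hasSum_delta η)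
    refine Filter.Tendsto.congr (fun s => ?_) h2
    refine Finset.sum_congr rfl fun g _ => ?_
    change (ξ g • delta g, η g • delta g) = (ξ g • delta g, ξ g • (ψ g : ℂ) • delta g)
    rw [h, smul_smul, mul_comm]
  refine mem_closure_of_tendsto hlim (Filter.Eventually.of_forall fun s => ?_)
  exact Submodule.sum_mem _ fun g _ =>
    Submodule.smul_mem _ _ (hψ.delta_mem_graph_pregenerator g)

end MultiplierSemigroup

/-! ### Stability of positive definite functions under powers and pointwise limits -/

section PosDefFun

variable {Γ : Type*} [Group Γ]

open scoped ComplexOrder in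
theorem IsPosDefFun.one : IsPosDefFun (fun _ : Γ => (1 : ℂ)) := by
  refine ⟨by ext; simp, fun x => ?_⟩
  have e : (x.sum fun i xi => x.sum fun j xj =>
      star xi * Matrix.of (fun g h : Γ => (fun _ : Γ => (1 : ℂ)) (g * h⁻¹)) i j * xj)
      = star (∑ g ∈ x.support, x g) * ∑ g ∈ x.support, x g := by
    simp [Finsupp.sum, star_sum, Finset.sum_mul_sum]
  rw [e]
  exact star_mul_self_nonneg _

/-- Schur product theorem: the kernel of f^(n+1) is the Hadamard product of the kernels of f^n and
f. -/
theorem IsPosDefFun.pow {f : Γ → ℂ} (hf : IsPosDefFun f) (n : ℕ) :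
    IsPosDefFun fun g => f g ^ n := by
  induction n with
  | zero => simpa using IsPosDefFun.one
  | succ n ih =>
    have := Matrix.PosSemidef.hadamard ih hf
    have e : Matrix.of (fun g h : Γ => (fun g => f g ^ (n + 1)) (g * h⁻¹))
        = Matrix.hadamard (Matrix.of fun g h : Γ => (fun g => f g ^ n) (g * h⁻¹))
          (Matrix.of fun g h : Γ => f (g * h⁻¹)) := by
      ext
      simp [Matrix.hadamard_apply, pow_succ]
    unfold IsPosDefFun
    rw [e]
    exact this

open scoped ComplexOrder in
theorem IsPosDefFun.of_tendsto {ι : Type*} {l : Filter ι} [l.NeBot] {F : ι → Γ → ℂ} {f : Γ → ℂ}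
    (hF : ∀ i, IsPosDefFun (F i)) (h : ∀ g, Filter.Tendsto (fun i => F i g) l (𝓝 (f g))) :
    IsPosDefFun f := by
  refine ⟨?_, fun x => ?_⟩
  · ext g k
    refine tendsto_nhds_unique (((h (k * g⁻¹)).star).congr fun i => ?_) (h (g * k⁻¹))
    exact congrFun (congrFun (hF i).1 g) k
  · refine ge_of_tendsto (x := l) ?_ (Filter.Eventually.of_forall fun i => (hF i).2 x)
    refine tendsto_finsetSum _ fun g _ => tendsto_finsetSum _ fun k _ => ?_
    exact ((h (g * k⁻¹)).const_mul _).mul_const _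

end PosDefFun

/-! ### The symbol of the averaged semigroup -/

section Average

variable {Γ : Type*} [Group Γ] (Φ : QMS Γ)

/-- The diagonal coefficient `⟨Φ_t(g) Ω, δ_g⟩`. -/
def QMS.symbol (t : ℝ≥0) (g : Γ) : ℂ := toL2 (Φ.toFun t (groupUnitary g)) g

theorem QMS.symbol_eq_l2 (t : ℝ≥0) (g : Γ) : Φ.symbol t g = Φ.l2 t (delta g) g := by
  rw [← toL2_groupUnitary, QMS.l2_toL2, QMS.symbol]

theorem QMS.symbol_one (t : ℝ≥0) : Φ.symbol t 1 = 1 := by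
  rw [QMS.symbol, _root_.map_one, Φ.map_one, toL2_one, delta_apply, if_pos rfl]

theorem QMS.symbol_zero (g : Γ) : Φ.symbol 0 g = 1 := by
  rw [QMS.symbol, Φ.map_zero, LinearMap.id_apply, toL2_groupUnitary, delta_apply, if_pos rfl]

theorem QMS.norm_symbol_le (t : ℝ≥0) (g : Γ) : ‖Φ.symbol t g‖ ≤ 1 := by
  calc ‖Φ.symbol t g‖ ≤ ‖toL2 (Φ.toFun t (groupUnitary g))‖ :=
        lp.norm_apply_le_norm (by simp) _ g
    _ ≤ ‖toL2 (groupUnitary g : GroupVN Γ)‖ := Φ.norm_toL2_le t _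
    _ = 1 := by rw [toL2_groupUnitary]; exact (orthonormal_delta Γ).1 g

/-- This is the symmetry of Φ_t with respect to the trace, tested on u_g and its inverse. -/
theorem QMS.symbol_inv (t : ℝ≥0) (g : Γ) : Φ.symbol t g⁻¹ = Φ.symbol t g := by
  have h := Φ.symmetric t (groupUnitary g) (groupUnitary g⁻¹)
  rw [trace_mul_eq_tsum, trace_mul_eq_tsum, toL2_groupUnitary, toL2_groupUnitary,
    tsum_eq_single g⁻¹, tsum_eq_single g⁻¹] at h
  · simpa [delta_apply, QMS.symbol] using h.symm
  · intro k hk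
    rw [delta_apply, if_neg (fun e => hk (by rw [← e, inv_inv])), zero_mul]
  · intro k hk
    rw [delta_apply, if_neg hk, mul_zero]

open scoped ComplexOrder in
-- The matrix with entries u_{γ_i} u_{γ_j}* is positive, hence so is its image under Φ_t. Evaluating
-- at the vectors z(γ_i)δ_{γ_i} leaves exactly the coefficients φ_t(γ_i γ_j⁻¹).
theorem QMS.symbol_form_nonneg (t : ℝ≥0) (s : Finset Γ) (z : Γ → ℂ) :
    0 ≤ ∑ g ∈ s, ∑ h ∈ s, (starRingEnd ℂ) (z g) * Φ.symbol t (g * h⁻¹) * z h := by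
  set e := s.equivFin
  set γ : Fin s.card → Γ := fun i => e.symm i with hγ
  have hpos : IsPositiveMatrix (Matrix.of fun i j => groupUnitary (γ i * (γ j)⁻¹)) := by
    intro ξ
    have hadj : ∀ i j, inner ℂ (ξ i) (((Matrix.of fun i j => groupUnitary (γ i * (γ j)⁻¹)) i j :
        Ell2 Γ →L[ℂ] Ell2 Γ) (ξ j))
        = inner ℂ (leftTranslation (γ i)⁻¹ (ξ i)) (leftTranslation (γ j)⁻¹ (ξ j)) := by
      intro i j
      rw [← star_leftTranslation (γ i), ContinuousLinearMap.star_eq_adjoint,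
        ContinuousLinearMap.adjoint_inner_left, Matrix.of_apply, _root_.map_mul]
      rfl
    simp only [hadj, ← inner_sum, ← sum_inner]
    rw [inner_self_eq_norm_sq_to_K]
    positivity
  have h := Φ.completelyPositive t _ _ hpos fun i => z (γ i) • delta (γ i)
  simp only [Matrix.map_apply, Matrix.of_apply, map_smul, inner_smul_left, inner_smul_right,
    inner_delta_left, groupVN_delta_apply] at h
  have h2 : ∀ F : Γ → ℂ, ∑ g ∈ s, F g = ∑ i, F (γ i) := by
    intro F
    rw [← Finset.sum_coe_sort, ← Equiv.sum_comp e.symm]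
  simp only [h2]
  refine h.trans_eq (Finset.sum_congr rfl fun i _ => Finset.sum_congr rfl fun j _ => ?_)
  rw [QMS.symbol]
  ring

theorem QMS.conj_symbol (t : ℝ≥0) (g : Γ) : (starRingEnd ℂ) (Φ.symbol t g) = Φ.symbol t g := by
  classical
  by_cases hg : g = 1
  · rw [hg, Φ.symbol_one, _root_.map_one]
  · have h := (Complex.le_def.1 (Φ.symbol_form_nonneg t {1, g} fun _ => 1)).2
    rw [Finset.sum_pair (Ne.symm hg), Finset.sum_pair (Ne.symm hg),
      Finset.sum_pair (Ne.symm hg)] at h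
    simp [Φ.symbol_one, Φ.symbol_inv] at h
    rw [Complex.conj_eq_iff_im]
    linarith

theorem QMS.isPosDefFun_symbol (t : ℝ≥0) : IsPosDefFun (Φ.symbol t) := by
  refine ⟨?_, fun x => Φ.symbol_form_nonneg t x.support x⟩
  ext g h
  change (starRingEnd ℂ) (Φ.symbol t (h * g⁻¹)) = Φ.symbol t (g * h⁻¹)
  rw [Φ.conj_symbol, ← Φ.symbol_inv]
  simp

/-- The adjoint of δ_k ↦ δ_{(k,k)} reads off the diagonal coefficients of Φ_t(u_g)Ω ⊗ δ_g, and only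
k = g survives. -/
theorem QMS.average_of (t : ℝ≥0) (g : Γ) :
    Φ.average t (MonoidAlgebra.of ℂ Γ g) = Φ.symbol t g • delta g := by
  have h : tensorToL2 (TensorProduct.map (Φ.toFun t) LinearMap.id
      (comult (MonoidAlgebra.of ℂ Γ g)))
      = l2Tensor (toL2 (Φ.toFun t (groupUnitary g))) (delta g) := by
    have hc : comult (MonoidAlgebra.of ℂ Γ g)
        = (groupUnitary g : GroupVN Γ) ⊗ₜ[ℂ] (groupUnitary g : GroupVN Γ) := by
      have : Coalgebra.comul (R := ℂ) (MonoidAlgebra.of ℂ Γ g)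
          = MonoidAlgebra.of ℂ Γ g ⊗ₜ[ℂ] MonoidAlgebra.of ℂ Γ g := by
        simp
      rw [comult, LinearMap.comp_apply, this, TensorProduct.map_tmul]
      simp only [AlgHom.toLinearMap_apply, ofGroupAlgebra_of]
    rw [hc, TensorProduct.map_tmul, LinearMap.id_apply, tensorToL2, TensorProduct.lift.tmul,
      LinearMap.compl₁₂_apply, toL2_groupUnitary]
  change ContinuousLinearMap.adjoint (comultL2 Γ).toContinuousLinearMap (tensorToL2
    (TensorProduct.map (Φ.toFun t) LinearMap.id (comult (MonoidAlgebra.of ℂ Γ g)))) = _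
  rw [h]
  refine Ell2.ext_inner fun k => ?_
  rw [← inner_delta_left, ContinuousLinearMap.adjoint_inner_right]
  have hk : (comultL2 Γ).toContinuousLinearMap (delta k) = delta (k, k) :=
    l2Map_delta _ _
  rw [hk, inner_delta_left]
  change toL2 (Φ.toFun t (groupUnitary g)) k * delta g k = _
  rw [lp.coeFn_smul, Pi.smul_apply, smul_eq_mul, delta_apply]
  split_ifs with e
  · rw [e, QMS.symbol]
  · simp

/-- This is the δ_g-coordinate of the difference quotient defining Δδ_g. The limit is real because
φ_t is, and nonnegative because |φ_t| ≤ 1. -/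
theorem QMS.exists_tendsto_symbol (hdom : ∀ x : MonoidAlgebra ℂ Γ, vec x ∈ Φ.generator.domain)
    (g : Γ) :
    ∃ c : ℝ, 0 ≤ c ∧ Filter.Tendsto (fun t : ℝ≥0 => ((t : ℝ) : ℂ)⁻¹ * (1 - Φ.symbol t g))
      (𝓝[>] 0) (𝓝 (c : ℂ)) := by
  have hg : delta g ∈ Φ.generator.domain := by
    rw [← vec_of]
    exact hdom _
  set c : ℂ := Φ.generator ⟨delta g, hg⟩ g with hc
  have hlim : Filter.Tendsto (fun t : ℝ≥0 => ((t : ℝ) : ℂ)⁻¹ * (1 - Φ.symbol t g))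
      (𝓝[>] 0) (𝓝 c) := by
    have h := (Φ.mem_graph_generator_iff _ _).1 (LinearPMap.mem_graph _ ⟨delta g, hg⟩)
    have h1 := ((innerSL ℂ (delta g : Ell2 Γ)).continuous.tendsto _).comp h
    simp only [Function.comp_def, innerSL_apply_apply, inner_delta_left] at h1
    refine h1.congr fun t => ?_
    rw [lp.coeFn_smul, Pi.smul_apply, lp.coeFn_sub, Pi.sub_apply, ← Φ.symbol_eq_l2, delta_apply,
      if_pos rfl, smul_eq_mul]
  have him : (starRingEnd ℂ) c = c := by
    refine tendsto_nhds_unique (hlim.star.congr fun t => ?_) hlim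
    change (starRingEnd ℂ) _ = _
    rw [_root_.map_mul, map_inv₀, map_sub, Φ.conj_symbol, _root_.map_one, Complex.conj_ofReal]
  obtain ⟨r, hr⟩ := Complex.conj_eq_iff_real.1 him
  rw [hr] at hlim
  refine ⟨r, ?_, hlim⟩
  have hre := (Complex.continuous_re.tendsto _).comp hlim
  rw [Complex.ofReal_re] at hre
  refine ge_of_tendsto hre (Filter.Eventually.of_forall fun t => ?_)
  simp only [Function.comp_apply]
  rw [← Complex.ofReal_inv, Complex.re_ofReal_mul]
  have h1 : (Φ.symbol t g).re ≤ 1 := (Complex.re_le_norm _).trans (Φ.norm_symbol_le t g)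
  have := t.2
  refine mul_nonneg (by positivity) ?_
  simpa using h1

/-- The function `ψ(g) = ⟨Δ δ_g, δ_g⟩`. -/
def QMS.length (hdom : ∀ x : MonoidAlgebra ℂ Γ, vec x ∈ Φ.generator.domain) (g : Γ) : ℝ :=
  (Φ.exists_tendsto_symbol hdom g).choose

variable (hdom : ∀ x : MonoidAlgebra ℂ Γ, vec x ∈ Φ.generator.domain)

theorem QMS.tendsto_symbol (g : Γ) :
    Filter.Tendsto (fun t : ℝ≥0 => ((t : ℝ) : ℂ)⁻¹ * (1 - Φ.symbol t g))
      (𝓝[>] 0) (𝓝 (Φ.length hdom g : ℂ)) := (Φ.exists_tendsto_symbol hdom g).choose_spec.2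

/-- Since φ_{t/n}(g) = 1 - tψ(g)/n + o(1/n), this is a scalar Chernoff product. It replaces the
semigroup law, which φ_t need not satisfy. -/
theorem QMS.tendsto_symbol_pow (t : ℝ≥0) (g : Γ) :
    Filter.Tendsto (fun n : ℕ => Φ.symbol (t / n) g ^ n) Filter.atTop
      (𝓝 ((Real.exp (-(t * Φ.length hdom g)) : ℝ) : ℂ)) := by
  rcases eq_or_ne t 0 with rfl | ht
  · simp [Φ.symbol_zero]
  · have h0 : Filter.Tendsto (fun n : ℕ => t / (n : ℝ≥0)) Filter.atTop (𝓝[>] 0) := by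
      refine tendsto_nhdsWithin_iff.2 ⟨tendsto_const_div_atTop_nhds_zero_nat t, ?_⟩
      filter_upwards [Filter.eventually_gt_atTop 0] with n hn
      have : 0 < t := pos_iff_ne_zero.2 ht
      exact div_pos this (by exact_mod_cast hn)
    have h1 := (((Φ.tendsto_symbol hdom g).comp h0).const_mul (-(t : ℂ)))
    have h2 := Complex.tendsto_one_add_pow_exp_of_tendsto
      (g := fun n : ℕ => Φ.symbol (t / n) g - 1) (t := -((t : ℂ) * Φ.length hdom g)) (by
        rw [← neg_mul]
        refine h1.congr' ?_
        filter_upwards [Filter.eventually_gt_atTop 0] with n hn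
        have hn' : (n : ℂ) ≠ 0 := by exact_mod_cast hn.ne'
        have ht' : ((t : ℝ) : ℂ) ≠ 0 := by exact_mod_cast ht
        simp only [Function.comp_apply, NNReal.coe_div, NNReal.coe_natCast, Complex.ofReal_div,
          Complex.ofReal_natCast]
        field_simp
        ring)
    simpa using h2

theorem QMS.isNegDefFun_length : IsNegDefFun (Φ.length hdom) where
  nonneg g := (Φ.exists_tendsto_symbol hdom g).choose_spec.1
  one := by
    have h := Φ.tendsto_symbol hdom 1
    simp only [Φ.symbol_one, sub_self, mul_zero] at h
    exact_mod_cast (tendsto_nhds_unique h tendsto_const_nhds)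
  inv g := by
    have h := Φ.tendsto_symbol hdom g⁻¹
    simp only [Φ.symbol_inv] at h
    exact_mod_cast (tendsto_nhds_unique h (Φ.tendsto_symbol hdom g))
  exp t := IsPosDefFun.of_tendsto (fun n => (Φ.isPosDefFun_symbol _).pow n)
    (Φ.tendsto_symbol_pow hdom t)

theorem QMS.isAveragedPregenerator :
    Φ.IsAveragedPregenerator (Φ.isNegDefFun_length hdom).pregenerator where
  domain_eq := (Φ.isNegDefFun_length hdom).pregenerator_domain
  tendsto g hg := by
    have e : (Φ.isNegDefFun_length hdom).pregenerator ⟨vec (MonoidAlgebra.of ℂ Γ g), hg⟩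
        = (Φ.length hdom g : ℂ) • delta g := by
      simp only [vec_of]
      exact (Φ.isNegDefFun_length hdom).pregenerator_delta g _
    rw [e]
    refine ((Φ.tendsto_symbol hdom g).smul_const (delta g : Ell2 Γ)).congr fun t => ?_
    rw [Φ.average_of, vec_of, mul_smul, sub_smul, one_smul]

theorem QMS.generator_delta_apply (g : Γ) (hg : delta g ∈ Φ.generator.domain) :
    Φ.generator ⟨delta g, hg⟩ g = (Φ.length hdom g : ℂ) := by
  have h := (Φ.mem_graph_generator_iff _ _).1 (LinearPMap.mem_graph _ ⟨delta g, hg⟩)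
  have h1 := ((innerSL ℂ (delta g : Ell2 Γ)).continuous.tendsto _).comp h
  simp only [Function.comp_def, innerSL_apply_apply, inner_delta_left] at h1
  refine tendsto_nhds_unique (h1.congr fun t => ?_) (Φ.tendsto_symbol hdom g)
  rw [lp.coeFn_smul, Pi.smul_apply, lp.coeFn_sub, Pi.sub_apply, ← Φ.symbol_eq_l2, delta_apply,
    if_pos rfl, smul_eq_mul]

end Average

/-! ### Powers of positive operators -/

theorem re_inner_le_of_le {H : Type*} [NormedAddCommGroup H] [InnerProductSpace ℂ H]
    {A B : H →L[ℂ] H} (h : A ≤ B) (ξ : H) :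
    RCLike.re (inner ℂ ξ (A ξ)) ≤ RCLike.re (inner ℂ ξ (B ξ)) := by
  have h1 := ((ContinuousLinearMap.le_def A B).1 h).re_inner_nonneg_right ξ
  simpa [inner_sub_right] using h1

section PositiveOperators

variable {H : Type*} [NormedAddCommGroup H] [InnerProductSpace ℂ H] [CompleteSpace H]

/-- For nonnegative exponents x^(r+s) = x^r x^s holds at x = 0 as well, so B need not be invertible.
-/
theorem rpow_add_of_exponent_nonneg (B : H →L[ℂ] H) {r s : ℝ} (hr : 0 ≤ r) (hs : 0 ≤ s) :
    B ^ (r + s) = B ^ r * B ^ s := by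
  rw [CFC.rpow_def, CFC.rpow_def, CFC.rpow_def, ← cfc_mul (fun x : ℝ≥0 => x ^ r)
    (fun x : ℝ≥0 => x ^ s) B (NNReal.continuous_rpow_const hr).continuousOn
    (NNReal.continuous_rpow_const hs).continuousOn]
  exact cfc_congr fun x _ => NNReal.rpow_add_of_nonneg x hr hs

theorem rpow_half_mul_rpow_half (B : H →L[ℂ] H) {r : ℝ} (hr : 0 ≤ r) :
    B ^ (r / 2) * B ^ (r / 2) = B ^ r := by
  rw [← rpow_add_of_exponent_nonneg B (by positivity) (by positivity), add_halves]

theorem adjoint_rpow (B : H →L[ℂ] H) (r : ℝ) :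
    ContinuousLinearMap.adjoint (B ^ r) = B ^ r := by
  have h : (0 : H →L[ℂ] H) ≤ B ^ r := CFC.rpow_nonneg
  exact (IsSelfAdjoint.of_nonneg h).adjoint_eq

theorem inner_rpow (B : H →L[ℂ] H) {r : ℝ} (hr : 0 ≤ r) (ξ η : H) :
    inner ℂ ξ ((B ^ r) η) = inner ℂ ((B ^ (r / 2)) ξ) ((B ^ (r / 2)) η) := by
  rw [← rpow_half_mul_rpow_half _ hr, mul_apply_eq_comp,
    ← ContinuousLinearMap.adjoint_inner_left, adjoint_rpow]

theorem re_inner_rpow (B : H →L[ℂ] H) {r : ℝ} (hr : 0 ≤ r) (ξ : H) :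
    RCLike.re (inner ℂ ξ ((B ^ r) ξ)) = ‖(B ^ (r / 2)) ξ‖ ^ 2 := by
  rw [inner_rpow _ hr, inner_self_eq_norm_sq]

/-- Jensen's inequality for powers of positive operators. -/
theorem re_inner_rpow_le {B : H →L[ℂ] H} (hB : 0 ≤ B) {p : ℝ} (hp : 1 ≤ p) {ξ : H}
    (hξ : ‖ξ‖ ≤ 1) :
    (‖(B ^ (1 / 2 : ℝ)) ξ‖ ^ 2) ^ p ≤ ‖(B ^ (p / 2)) ξ‖ ^ 2 := by
  rw [← re_inner_rpow _ zero_le_one, ← re_inner_rpow _ (by linarith), CFC.rpow_one B hB]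
  set μ : ℝ := RCLike.re (inner ℂ ξ (B ξ)) with hμ
  have hμ0 : 0 ≤ μ := by
    simpa [hμ] using re_inner_le_of_le hB ξ
  rcases hμ0.eq_or_lt with h0 | h0
  · rw [← h0, Real.zero_rpow (by linarith)]
    rw [re_inner_rpow _ (by linarith)]
    positivity
  · have hsa : IsSelfAdjoint B := IsSelfAdjoint.of_nonneg hB
    -- The tangent line of the convex function x^p at μ = ⟨Bξ, ξ⟩ lies below it on the spectrum
    -- (Bernoulli's inequality at x/μ - 1); the functional calculus turns this into an operator
    -- inequality.
    have hle : algebraMap ℝ (H →L[ℂ] H) ((1 - p) * μ ^ p) + (p * μ ^ (p - 1)) • B ≤ B ^ p := by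
      have e1 : algebraMap ℝ (H →L[ℂ] H) ((1 - p) * μ ^ p) + (p * μ ^ (p - 1)) • B
          = cfc (fun x : ℝ => (1 - p) * μ ^ p + (p * μ ^ (p - 1)) * x) B := by
        rw [cfc_const_add _ _ B (by fun_prop) hsa, cfc_const_mul_id _ B hsa]
      rw [e1, CFC.rpow_eq_cfc_real hB]
      refine cfc_mono (fun x hx => ?_) (by fun_prop)
        (ContinuousOn.rpow_const continuousOn_id fun x _ => Or.inr (by linarith))
      have hx0 : 0 ≤ x := spectrum_nonneg_of_nonneg hB hx
      have hb := one_add_mul_self_le_rpow_one_add (s := x / μ - 1) (p := p)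
        (by linarith [div_nonneg hx0 h0.le]) hp
      have e2 : (1 + (x / μ - 1)) ^ p = x ^ p / μ ^ p := by
        rw [← Real.div_rpow hx0 h0.le]; ring_nf
      have hpp : 0 < μ ^ p := Real.rpow_pos_of_pos h0 p
      rw [e2, le_div_iff₀ hpp] at hb
      rw [Real.rpow_sub h0, Real.rpow_one]
      calc _ = (1 + p * (x / μ - 1)) * μ ^ p := by field_simp; ring
        _ ≤ _ := hb
    have h := re_inner_le_of_le hle ξ
    have e3 : RCLike.re (inner ℂ ξ ((algebraMap ℝ (H →L[ℂ] H) ((1 - p) * μ ^ p)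
        + (p * μ ^ (p - 1)) • B) ξ)) = (1 - p) * μ ^ p * ‖ξ‖ ^ 2 + p * μ ^ (p - 1) * μ := by
      rw [add_apply, inner_add_right, map_add, Algebra.algebraMap_eq_smul_one]
      simp only [smul_apply, one_apply_eq_self]
      rw [RCLike.real_smul_eq_coe_smul (K := ℂ), RCLike.real_smul_eq_coe_smul (K := ℂ),
        inner_smul_right, inner_smul_right, RCLike.re_ofReal_mul, RCLike.re_ofReal_mul,
        inner_self_eq_norm_sq]
    rw [e3] at h
    refine le_trans ?_ h
    have e4 : μ ^ (p - 1) * μ = μ ^ p := by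
      rw [← Real.rpow_add_one h0.ne']; ring_nf
    rw [mul_assoc p, e4]
    have hpp : 0 < μ ^ p := Real.rpow_pos_of_pos h0 p
    -- The constant term (1 - p)μ^p of the tangent is nonpositive, so ‖ξ‖ ≤ 1 suffices in place of a
    -- unit vector.
    have h5 : ‖ξ‖ ^ 2 ≤ 1 := pow_le_one₀ (norm_nonneg _) hξ
    nlinarith [mul_nonneg (mul_nonneg (sub_nonneg.2 hp) hpp.le) (sub_nonneg.2 h5)]

theorem norm_abs_apply (T : H →L[ℂ] H) (ξ : H) : ‖CFC.abs T ξ‖ = ‖T ξ‖ := by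
  have h1 : inner ℂ (CFC.abs T ξ) (CFC.abs T ξ) = inner ℂ (T ξ) (T ξ) := by
    have h := CFC.abs_mul_abs T
    have h2 := congrArg (fun S : H →L[ℂ] H => inner ℂ ξ (S ξ)) h
    simp only [mul_apply_eq_comp] at h2
    rw [← ContinuousLinearMap.adjoint_inner_left,
      (IsSelfAdjoint.of_nonneg (CFC.abs_nonneg T)).adjoint_eq, ContinuousLinearMap.star_eq_adjoint,
      ContinuousLinearMap.adjoint_inner_right] at h2
    exact h2
  have h3 : ‖CFC.abs T ξ‖ ^ 2 = ‖T ξ‖ ^ 2 := by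
    rw [← inner_self_eq_norm_sq (𝕜 := ℂ), ← inner_self_eq_norm_sq (𝕜 := ℂ), h1]
  exact (sq_eq_sq₀ (norm_nonneg _) (norm_nonneg _)).1 h3

/-- Polar decomposition: `T = V |T|` with a contraction `V`. -/
theorem exists_polar (T : H →L[ℂ] H) :
    ∃ V : H →L[ℂ] H, ‖V‖ ≤ 1 ∧ ∀ ξ, V (CFC.abs T ξ) = T ξ := by
  set B := CFC.abs T with hB
  set K : Submodule ℂ H := (LinearMap.range B.toLinearMap).topologicalClosure with hK
  have hmem : ∀ ξ, B ξ ∈ K := fun ξ => Submodule.le_topologicalClosure _ ⟨ξ, rfl⟩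
  let e : H →ₗ[ℂ] K := B.toLinearMap.codRestrict K hmem
  have hd : DenseRange e := by
    intro y
    rw [Metric.mem_closure_range_iff]
    intro ε hε
    obtain ⟨_, ⟨ξ, rfl⟩, hz⟩ := Metric.mem_closure_iff.1 y.2 ε hε
    exact ⟨ξ, hz⟩
  have hn : ∀ ξ, ‖T.toLinearMap ξ‖ ≤ 1 * ‖e ξ‖ := fun ξ => by
    rw [one_mul]
    exact (norm_abs_apply T ξ).ge
  have hcl : IsClosed (K : Set H) := Submodule.isClosed_topologicalClosure _
  have : CompleteSpace K := hcl.completeSpace_coe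
  -- V is |T|ξ ↦ Tξ on the closed range of |T| and zero on its orthogonal complement.
  refine ⟨(T.toLinearMap.extendOfNorm e) ∘L K.orthogonalProjectionOnto, ?_, fun ξ => ?_⟩
  · calc _ ≤ ‖T.toLinearMap.extendOfNorm e‖ * ‖K.orthogonalProjectionOnto‖ :=
          ContinuousLinearMap.opNorm_comp_le _ _
      _ ≤ 1 * 1 := by
        gcongr
        · exact LinearMap.opNorm_extendOfNorm_le hd zero_le_one hn
        · exact K.orthogonalProjectionOnto_norm_le
      _ = 1 := one_mul 1
  · have h1 : K.orthogonalProjectionOnto (B ξ) = e ξ :=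
      K.orthogonalProjectionOnto_mem_subspace_eq_self (e ξ)
    rw [ContinuousLinearMap.comp_apply, h1]
    exact LinearMap.extendOfNorm_eq hd ⟨1, hn⟩ ξ

/-- A factorization `T = V S²`, with `S = |T|^(1/2)` and `R = |T|^(p/2)`. -/
theorem exists_absPow_factorization (T : H →L[ℂ] H) {p : ℝ} (hp : 1 ≤ p) :
    ∃ V S R : H →L[ℂ] H, ‖V‖ ≤ 1 ∧ ContinuousLinearMap.adjoint S = S ∧
      ContinuousLinearMap.adjoint R = R ∧ (∀ ξ, V (S (S ξ)) = T ξ) ∧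
      (∀ ξ, RCLike.re (inner ℂ ξ (absPow T p ξ)) = ‖R ξ‖ ^ 2) ∧
      ∀ ξ, ‖ξ‖ ≤ 1 → (‖S ξ‖ ^ 2) ^ p ≤ ‖R ξ‖ ^ 2 := by
  obtain ⟨V, hV, hVT⟩ := exists_polar T
  have hB : 0 ≤ CFC.abs T := CFC.abs_nonneg T
  refine ⟨V, CFC.abs T ^ (1 / 2 : ℝ), CFC.abs T ^ (p / 2), hV, adjoint_rpow _ _,
    adjoint_rpow _ _, fun ξ => ?_, fun ξ => re_inner_rpow _ (by linarith) ξ,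
    fun ξ hξ => re_inner_rpow_le hB hp hξ⟩
  rw [← mul_apply_eq_comp (CFC.abs T ^ (1 / 2 : ℝ)), rpow_half_mul_rpow_half _ zero_le_one,
    CFC.rpow_one _ hB, hVT]

end PositiveOperators

/-! ### Matrix coefficients of operators in Schatten classes -/

section SchattenCoefficients

variable {α : Type*}

/-- Hilbert–Schmidt norms do not increase under A ↦ AV* or on passing to another orthonormal family:
expand in coordinates, exchange the sums, and apply Bessel to VAδ_h. -/
theorem summable_norm_sq_apply_adjoint {A V : Ell2 α →L[ℂ] Ell2 α} (hV : ‖V‖ ≤ 1)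
    (hA : ContinuousLinearMap.adjoint A = A) (hs : Summable fun h => ‖A (delta h)‖ ^ 2)
    {f : α → Ell2 α} (hf : Orthonormal ℂ f) :
    Summable fun g => ‖A (ContinuousLinearMap.adjoint V (f g))‖ ^ 2 := by
  have hc : ∀ g h, A (ContinuousLinearMap.adjoint V (f g)) h = inner ℂ (V (A (delta h))) (f g) := by
    intro g h
    rw [← inner_delta_left, ← ContinuousLinearMap.adjoint_inner_left, hA,
      ContinuousLinearMap.adjoint_inner_right]
  have hV' : ∀ h, ‖V (A (delta h))‖ ^ 2 ≤ ‖A (delta h)‖ ^ 2 := fun h => by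
    gcongr
    exact V.le_of_opNorm_le hV _ |>.trans_eq (one_mul _)
  refine summable_of_sum_le (c := ∑' h, ‖A (delta h)‖ ^ 2) (fun g => by positivity) fun s => ?_
  simp only [norm_sq_eq_tsum]
  rw [← Summable.tsum_finsetSum fun g _ => summable_norm_sq _]
  simp only [← norm_sq_eq_tsum]
  refine Summable.tsum_le_tsum (fun h => ?_) (summable_sum fun g _ => summable_norm_sq _) hs
  simp only [hc]
  refine le_trans ?_ (hV' h)
  simp only [norm_inner_symm (V (A (delta h)))]
  exact hf.sum_inner_products_le _

/-- With T = VS² the coefficient is ⟨SV*f_g, Sδ_g⟩. Cauchy–Schwarz splits it, Jensen replaces the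
p-th powers by the squared norms of RV*f_g and Rδ_g, where R = |T|^(p/2), and both are summable
because R is Hilbert–Schmidt. -/
theorem summable_inner_rpow_of_schatten {T : Ell2 α →L[ℂ] Ell2 α} {p : ℝ} (hp : 1 ≤ p)
    (hT : Summable fun g => RCLike.re (inner ℂ (delta g) (absPow T p (delta g))))
    {f : α → Ell2 α} (hf : Orthonormal ℂ f) :
    Summable fun g => ‖(inner ℂ (f g) (T (delta g)) : ℂ)‖ ^ p := by
  obtain ⟨V, S, R, hV, hS, hR, hVT, hTR, hSR⟩ := exists_absPow_factorization T hp
  simp only [hTR] at hT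
  have h2 := summable_norm_sq_apply_adjoint hV hR hT hf
  refine Summable.of_nonneg_of_le (fun g => by positivity) (fun g => ?_) (h2.add hT)
  set u := ContinuousLinearMap.adjoint V (f g) with hu
  have hu1 : ‖u‖ ≤ 1 := by
    refine ((ContinuousLinearMap.adjoint V).le_opNorm _).trans ?_
    rw [LinearIsometryEquiv.norm_map, hf.1 g, mul_one]
    exact hV
  have hd1 : ‖(delta g : Ell2 α)‖ ≤ 1 := ((orthonormal_delta α).1 g).le
  have e : inner ℂ (f g) (T (delta g)) = inner ℂ (S u) (S (delta g)) := by
    rw [← hVT, ← ContinuousLinearMap.adjoint_inner_left, ← hu,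
      ← ContinuousLinearMap.adjoint_inner_left, hS]
  rw [e]
  have hx := hSR u hu1
  have hy := hSR (delta g) hd1
  have hswap : ∀ x : ℝ, 0 ≤ x → (x ^ 2) ^ p = (x ^ p) ^ 2 := fun x hx => by
    rw [← Real.rpow_natCast, ← Real.rpow_natCast, ← Real.rpow_mul hx, ← Real.rpow_mul hx, mul_comm]
  rw [hswap _ (norm_nonneg _)] at hx hy
  calc ‖inner ℂ (S u) (S (delta g))‖ ^ p ≤ (‖S u‖ * ‖S (delta g)‖) ^ p := by
        gcongr
        exact norm_inner_le_norm _ _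
    _ = ‖S u‖ ^ p * ‖S (delta g)‖ ^ p := Real.mul_rpow (norm_nonneg _) (norm_nonneg _)
    _ ≤ (‖S u‖ ^ p) ^ 2 + (‖S (delta g)‖ ^ p) ^ 2 := by
        nlinarith [sq_nonneg (‖S u‖ ^ p - ‖S (delta g)‖ ^ p), sq_nonneg (‖S u‖ ^ p),
          sq_nonneg (‖S (delta g)‖ ^ p)]
    _ ≤ _ := add_le_add hx hy

/-- A compact operator maps the standard basis to a family that tends to zero. -/
theorem tendsto_delta_of_isCompactOperator {T : Ell2 α →L[ℂ] Ell2 α} (hT : IsCompactOperator T) :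
    Filter.Tendsto (fun g => T (delta g)) Filter.cofinite (𝓝 0) := by
  obtain ⟨K, hK, hKT⟩ := hT.image_closedBall_subset_compact (f := T.toLinearMap) 1
  -- The images stay in a compact set, so it suffices that 0 is the only cluster point. Each
  -- coordinate tends to 0, since up to conjugation the a-th coordinate of Tδ_g is the g-th
  -- coordinate of T*δ_a.
  refine hK.tendsto_nhds_of_unique_mapClusterPt (Filter.Eventually.of_forall fun g => hKT
    ⟨delta g, by simp [(orthonormal_delta α).1 g], rfl⟩) fun y _ hy => ?_
  refine Ell2.ext_inner fun a => ?_
  have h0 : Filter.Tendsto (fun g => T (delta g) a) Filter.cofinite (𝓝 0) := by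
    have h1 := (summable_norm_sq (ContinuousLinearMap.adjoint T (delta a))).tendsto_cofinite_zero
    have h2 : ∀ g, ‖T (delta g) a‖ ^ 2 = ‖ContinuousLinearMap.adjoint T (delta a) g‖ ^ 2 := by
      intro g
      rw [← inner_delta_left, ← inner_delta_left, ContinuousLinearMap.adjoint_inner_right,
        norm_inner_symm]
    simp only [← h2] at h1
    have h3 := h1.sqrt
    simp only [Real.sqrt_sq (norm_nonneg _), Real.sqrt_zero] at h3
    exact tendsto_zero_iff_norm_tendsto_zero.2 h3
  have hcont : Continuous fun ξ : Ell2 α => ξ a := by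
    have : (fun ξ : Ell2 α => ξ a) = fun ξ => innerSL ℂ (delta a : Ell2 α) ξ := by
      ext ξ
      rw [innerSL_apply_apply, inner_delta_left]
    rw [this]
    fun_prop
  have h4 : MapClusterPt (y a) Filter.cofinite fun g => T (delta g) a :=
    hy.continuousAt_comp hcont.continuousAt
  have h5 : ClusterPt (y a) (𝓝 (0 : ℂ)) := ClusterPt.mono h4 h0
  exact eq_of_nhds_neBot h5

end SchattenCoefficients

/-! ### Operators dominated by diagonal operators -/

/-- The product is at most the larger of x and y to the power u + s. This decouples weights on rows
from weights on columns. -/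
theorem mul_rpow_le_add {x y u s : ℝ} (hx : 0 ≤ x) (hy : 0 ≤ y) (hu : 0 ≤ u) (hs : 0 ≤ s) :
    x ^ u * y ^ s ≤ x ^ (u + s) + y ^ (u + s) := by
  rcases le_total x y with h | h
  · calc x ^ u * y ^ s ≤ y ^ u * y ^ s := by gcongr
      _ = y ^ (u + s) := (Real.rpow_add_of_nonneg hy hu hs).symm
      _ ≤ _ := le_add_of_nonneg_left (by positivity)
  · calc x ^ u * y ^ s ≤ x ^ u * x ^ s := by gcongr
      _ = x ^ (u + s) := (Real.rpow_add_of_nonneg hx hu hs).symm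
      _ ≤ _ := le_add_of_nonneg_right (by positivity)

/-- Tonelli handles the row weights; symmetry of the matrix turns the column weights into row
weights. -/
theorem summable_symm_weighted {α : Type*} {a : α → α → ℝ} {w x : α → ℝ} (ha : ∀ i j, 0 ≤ a i j)
    (hsymm : ∀ i j, a i j = a j i) (hrow : ∀ i, HasSum (a i) (x i)) (hw : ∀ i, 0 ≤ w i)
    (h : Summable fun i => w i * x i) :
    Summable fun z : α × α => (w z.1 + w z.2) * a z.1 z.2 := by
  have h1 : Summable fun z : α × α => w z.1 * a z.1 z.2 := by
    have h0 : 0 ≤ fun z : α × α => w z.1 * a z.1 z.2 := fun z => mul_nonneg (hw _) (ha _ _)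
    rw [summable_prod_of_nonneg h0]
    have h3 : ∀ i, HasSum (fun j => w i * a i j) (w i * x i) := fun i => (hrow i).mul_left (w i)
    refine ⟨fun i => (h3 i).summable, h.congr fun i => (h3 i).tsum_eq.symm⟩
  have h2 : Summable fun z : α × α => w z.2 * a z.1 z.2 := by
    refine ((Equiv.prodComm α α).summable_iff.2 h1).congr fun z => ?_
    simp only [Function.comp_apply, Equiv.prodComm_apply, Prod.fst_swap, Prod.snd_swap]
    rw [hsymm]
  exact (h1.add h2).congr fun z => (add_mul _ _ _).symm

section Domination

variable {H : Type*} [NormedAddCommGroup H] [InnerProductSpace ℂ H] [CompleteSpace H]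

/-- The continuous functional calculus on an eigenvector. -/
theorem cfc_apply_of_eigenvector {D : H →L[ℂ] H} (hD : IsSelfAdjoint D) {ξ : H} {c : ℝ}
    (hξ : ξ ≠ 0) (h : D ξ = (c : ℂ) • ξ) {f : ℝ → ℝ} (hf : ContinuousOn f (spectrum ℝ D)) :
    cfc f D ξ = (f c : ℂ) • ξ := by
  have hc : c ∈ spectrum ℝ D := by
    rw [spectrum.mem_iff]
    intro hu
    obtain ⟨u, hu⟩ := hu
    have h0 : (u : H →L[ℂ] H) ξ = 0 := by
      rw [hu, Algebra.algebraMap_eq_smul_one, sub_apply, smul_apply, one_apply_eq_self, h,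
        RCLike.real_smul_eq_coe_smul (K := ℂ)]
      exact sub_self _
    have h1 : ((↑u⁻¹ : H →L[ℂ] H) * u) ξ = ξ := by
      rw [Units.inv_mul, one_apply_eq_self]
    rw [mul_apply_eq_comp, h0, map_zero] at h1
    exact hξ h1.symm
  rw [cfc_apply f D hD hf]
  have key : ∀ g : C(spectrum ℝ D, ℝ), cfcHom hD g ξ = (g ⟨c, hc⟩ : ℂ) • ξ := by
    intro g
    induction g using ContinuousMap.induction_on_of_compact with
    | const r =>
      have : cfcHom hD (ContinuousMap.const _ r) = algebraMap ℝ (H →L[ℂ] H) r :=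
        AlgHomClass.commutes (cfcHom hD) r
      rw [this, Algebra.algebraMap_eq_smul_one, smul_apply, one_apply_eq_self,
        RCLike.real_smul_eq_coe_smul (K := ℂ)]
      rfl
    | id =>
      rw [cfcHom_id hD, h]
      rfl
    | star_id =>
      rw [map_star, cfcHom_id hD, hD.star_eq, h]
      simp
    | add f g hf hg =>
      rw [map_add, add_apply, hf, hg, ← add_smul]
      simp
    | mul f g hf hg =>
      rw [map_mul, mul_apply_eq_comp, hg, map_smul, hf, smul_smul]
      simp [mul_comm]
    | frequently f hf =>
      have hcl : IsClosed {g : C(spectrum ℝ D, ℝ) | cfcHom hD g ξ = (g ⟨c, hc⟩ : ℂ) • ξ} := by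
        refine isClosed_eq ?_ ?_
        · exact (ContinuousLinearMap.apply ℂ H ξ).continuous.comp (cfcHom_continuous hD)
        · fun_prop
      have hmem : f ∈ closure {g : C(spectrum ℝ D, ℝ) | cfcHom hD g ξ = (g ⟨c, hc⟩ : ℂ) • ξ} :=
        mem_closure_iff_frequently.2 hf
      rw [hcl.closure_eq] at hmem
      exact hmem
  rw [key]
  rfl

theorem rpow_apply_of_eigenvector {D : H →L[ℂ] H} (hD : 0 ≤ D) {ξ : H} {c : ℝ}
    (hξ : ξ ≠ 0) (h : D ξ = (c : ℂ) • ξ) {s : ℝ} (hs : 0 ≤ s) :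
    (D ^ s) ξ = ((c ^ s : ℝ) : ℂ) • ξ := by
  rw [CFC.rpow_eq_cfc_real hD]
  exact cfc_apply_of_eigenvector (IsSelfAdjoint.of_nonneg hD) hξ h
    (ContinuousOn.rpow_const continuousOn_id fun x _ => Or.inr hs)

variable {α : Type*} {e : α → H} {D X : H →L[ℂ] H} {d : α → ℝ}

theorem hasSum_re_inner_rpow_diagonal (he : Orthonormal ℂ e)
    (hP : ∀ ξ, HasSum (fun g => ‖(inner ℂ (e g) ξ : ℂ)‖ ^ 2) (‖ξ‖ ^ 2)) (hD : 0 ≤ D)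
    (hd : ∀ g, 0 ≤ d g) (hDe : ∀ g, D (e g) = (d g : ℂ) • e g) {s : ℝ} (hs : 0 ≤ s) (η : H) :
    HasSum (fun g => d g ^ s * ‖(inner ℂ (e g) η : ℂ)‖ ^ 2)
      (RCLike.re (inner ℂ η ((D ^ s) η))) := by
  rw [re_inner_rpow D hs]
  have h : ∀ g, ‖(inner ℂ (e g) ((D ^ (s / 2)) η) : ℂ)‖ ^ 2
      = d g ^ s * ‖(inner ℂ (e g) η : ℂ)‖ ^ 2 := by
    intro g
    rw [← ContinuousLinearMap.adjoint_inner_left, adjoint_rpow,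
      rpow_apply_of_eigenvector hD (he.ne_zero g) (hDe g) (by positivity), inner_smul_left,
      norm_mul, mul_pow, Complex.conj_ofReal,
      Complex.norm_of_nonneg (Real.rpow_nonneg (hd g) _), sq, ← Real.rpow_add_of_nonneg (hd g)
        (by positivity) (by positivity), add_halves]
  simpa only [h] using hP ((D ^ (s / 2)) η)

/-- Write X^(r+s) = X^(r/2) X^s X^(r/2) and use operator monotonicity of x^s (Löwner–Heinz), which
requires s ≤ 1. -/
theorem re_inner_rpow_add_le (hX : X ≤ D) {r s : ℝ} (hr : 0 ≤ r) (hs : 0 ≤ s)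
    (hs1 : s ≤ 1) (ξ : H) :
    RCLike.re (inner ℂ ξ ((X ^ (r + s)) ξ))
      ≤ RCLike.re (inner ℂ ((X ^ (r / 2)) ξ) ((D ^ s) ((X ^ (r / 2)) ξ))) := by
  have h := re_inner_le_of_le (CFC.rpow_le_rpow ⟨hs, hs1⟩ hX) ((X ^ (r / 2)) ξ)
  refine le_trans (le_of_eq ?_) h
  rw [← ContinuousLinearMap.adjoint_inner_right, adjoint_rpow, ← mul_apply_eq_comp,
    ← mul_apply_eq_comp, ← rpow_add_of_exponent_nonneg X (by positivity) hs,
    ← rpow_add_of_exponent_nonneg X (by positivity) (by positivity), add_right_comm, add_halves]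

/-- The inductive step for traces of powers of `X ≤ D`, with `D` diagonal. -/
theorem summable_weighted_rpow_step (he : Orthonormal ℂ e)
    (hP : ∀ ξ, HasSum (fun g => ‖(inner ℂ (e g) ξ : ℂ)‖ ^ 2) (‖ξ‖ ^ 2)) (hD : 0 ≤ D)
    (hd : ∀ g, 0 ≤ d g) (hDe : ∀ g, D (e g) = (d g : ℂ) • e g) (hX : X ≤ D)
    {r s u : ℝ} (hr : 0 ≤ r) (hs : 0 ≤ s) (hs1 : s ≤ 1) (hu : 0 ≤ u)
    (h : Summable fun g => d g ^ (u + s) * RCLike.re (inner ℂ (e g) ((X ^ r) (e g)))) :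
    Summable fun g => d g ^ u * RCLike.re (inner ℂ (e g) ((X ^ (r + s)) (e g))) := by
  set a : α → α → ℝ := fun x y => ‖(inner ℂ (e y) ((X ^ (r / 2)) (e x)) : ℂ)‖ ^ 2 with ha
  have hsymm : ∀ x y, a x y = a y x := by
    intro x y
    simp only [ha]
    rw [← ContinuousLinearMap.adjoint_inner_left, adjoint_rpow, norm_inner_symm]
  have ha0 : ∀ x y, 0 ≤ a x y := fun x y => by positivity
  have hrow : ∀ x, HasSum (a x) (RCLike.re (inner ℂ (e x) ((X ^ r) (e x)))) := by
    intro x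
    rw [re_inner_rpow X hr]
    exact hP _
  have h0 := summable_symm_weighted ha0 hsymm hrow (fun g => Real.rpow_nonneg (hd g) (u + s)) h
  -- Here a(x, y) = |⟨e_y, X^(r/2)e_x⟩|² is symmetric with row sums ⟨X^r e_x, e_x⟩, and the mixed
  -- weight d_x^u d_y^s is at most d_x^(u+s) + d_y^(u+s).
  have h3 : Summable fun z : α × α => d z.1 ^ u * (d z.2 ^ s * a z.1 z.2) := by
    refine Summable.of_nonneg_of_le (fun z => mul_nonneg (Real.rpow_nonneg (hd _) _)
      (mul_nonneg (Real.rpow_nonneg (hd _) _) (ha0 _ _))) (fun z => ?_) h0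
    rw [← mul_assoc]
    exact mul_le_mul_of_nonneg_right (mul_rpow_le_add (hd _) (hd _) hu hs) (ha0 _ _)
  refine Summable.of_nonneg_of_le (fun x => mul_nonneg (Real.rpow_nonneg (hd _) _) ?_)
    (fun x => ?_) h3.prod
  · rw [re_inner_rpow X (by positivity)]
    positivity
  · have h4 := hasSum_re_inner_rpow_diagonal he hP hD hd hDe hs ((X ^ (r / 2)) (e x))
    simp only
    rw [tsum_mul_left, h4.tsum_eq]
    exact mul_le_mul_of_nonneg_left (re_inner_rpow_add_le hX hr hs hs1 (e x))
      (Real.rpow_nonneg (hd _) _)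

/-- If `0 ≤ X ≤ D` with `D` diagonal, then `Tr X^q < ∞` as soon as `Tr D^q < ∞`. -/
theorem summable_rpow_of_le_diagonal (he : Orthonormal ℂ e)
    (hP : ∀ ξ, HasSum (fun g => ‖(inner ℂ (e g) ξ : ℂ)‖ ^ 2) (‖ξ‖ ^ 2)) (hX0 : 0 ≤ X)
    (hd : ∀ g, 0 ≤ d g) (hDe : ∀ g, D (e g) = (d g : ℂ) • e g) (hX : X ≤ D)
    {q : ℝ} (hq : 0 ≤ q) (h : Summable fun g => d g ^ q) :
    Summable fun g => RCLike.re (inner ℂ (e g) ((X ^ q) (e g))) := by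
  have hD : 0 ≤ D := hX0.trans hX
  -- X ≤ D does not imply X^q ≤ D^q for q > 1, so exponent is moved from the weight d to X one unit
  -- at a time, with the fractional part of q last.
  have key : ∀ n : ℕ, (n : ℝ) ≤ q → Summable fun g =>
      d g ^ (q - n) * RCLike.re (inner ℂ (e g) ((X ^ (n : ℝ)) (e g))) := by
    intro n
    induction n with
    | zero =>
      intro _
      refine h.congr fun g => ?_
      rw [Nat.cast_zero, CFC.rpow_zero X hX0, one_apply_eq_self, inner_self_eq_norm_sq, he.1 g]
      simp
    | succ n ih =>
      intro hn
      push_cast at hn ⊢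
      refine summable_weighted_rpow_step he hP hD hd hDe hX n.cast_nonneg zero_le_one le_rfl
        (sub_nonneg.2 hn) ?_
      rw [show q - (n + 1) + 1 = q - n by ring]
      exact ih (by linarith)
  have hn := Nat.floor_le hq
  have hn' := (Nat.lt_floor_add_one q).le
  have h2 := summable_weighted_rpow_step he hP hD hd hDe hX (r := (⌊q⌋₊ : ℝ)) (s := q - ⌊q⌋₊)
    (u := 0) (Nat.cast_nonneg _) (sub_nonneg.2 hn) (by linarith) le_rfl (by
      rw [zero_add]
      exact key _ hn)
  simpa using h2

/-- An operator dominated by a diagonal operator in the Schatten class is in the Schatten class. -/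
theorem summable_absPow_of_norm_le_diagonal (he : Orthonormal ℂ e)
    (hP : ∀ ξ, HasSum (fun g => ‖(inner ℂ (e g) ξ : ℂ)‖ ^ 2) (‖ξ‖ ^ 2)) {T M : H →L[ℂ] H}
    (hM : IsSelfAdjoint M) {m : α → ℝ} (hm : ∀ g, 0 ≤ m g)
    (hMe : ∀ g, M (e g) = (m g : ℂ) • e g) (hTM : ∀ ξ, ‖T ξ‖ ≤ ‖M ξ‖) {p : ℝ} (hp : 0 ≤ p)
    (h : Summable fun g => m g ^ p) :
    Summable fun g => RCLike.re (inner ℂ (e g) (absPow T p (e g))) := by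
  have hX0 : 0 ≤ star T * T := star_mul_self_nonneg T
  have hT : absPow T p = (star T * T) ^ (p / 2) := by
    change (CFC.sqrt (star T * T)) ^ p = _
    rw [CFC.sqrt_eq_rpow, CFC.rpow_rpow_of_exponent_nonneg _ _ _ (by norm_num) hp]
    ring_nf
  -- The norm domination says exactly T*T ≤ M², and |T|^p = (T*T)^(p/2); the diagonal comparison
  -- then applies with entries m² and exponent p/2.
  have hle : star T * T ≤ M * M := by
    rw [ContinuousLinearMap.le_def, ContinuousLinearMap.isPositive_iff_complex]
    intro ξ
    have e1 : inner ℂ ((M * M - star T * T) ξ) ξ = ((‖M ξ‖ ^ 2 - ‖T ξ‖ ^ 2 : ℝ) : ℂ) := by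
      rw [sub_apply, inner_sub_left, mul_apply_eq_comp, mul_apply_eq_comp,
        ContinuousLinearMap.star_eq_adjoint, ContinuousLinearMap.adjoint_inner_left]
      nth_rewrite 1 [← hM.adjoint_eq]
      rw [ContinuousLinearMap.adjoint_inner_left, inner_self_eq_norm_sq_to_K,
        inner_self_eq_norm_sq_to_K]
      push_cast
      rfl
    rw [e1]
    refine ⟨congrArg Complex.ofReal (Complex.ofReal_re _), ?_⟩
    refine le_of_le_of_eq ?_ (Complex.ofReal_re _).symm
    exact sub_nonneg.2 (pow_le_pow_left₀ (norm_nonneg _) (hTM ξ) 2)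
  rw [hT]
  refine summable_rpow_of_le_diagonal he hP hX0 (d := fun g => m g ^ 2) (fun g => by positivity)
    (fun g => ?_) hle (by positivity) (h.congr fun g => ?_)
  · rw [mul_apply_eq_comp, hMe, map_smul, hMe, smul_smul]
    push_cast
    rw [sq]
  · rw [← Real.rpow_natCast, ← Real.rpow_mul (hm g)]
    congr 1
    push_cast
    ring

end Domination

/-! ### Schatten operators on `ℓ²` -/

section DiagDominated

variable {α : Type*}

/-- For `p = ∞` the compact operators, for `p < ∞` the operators dominated by the operator of
multiplication by an `ℓ^p` function. -/
def IsDiagDominated (p : ℝ≥0∞) (T : Ell2 α →L[ℂ] Ell2 α) : Prop :=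
  if p = ∞ then IsCompactOperator T
  else ∃ (m : α → ℝ) (hb : ∃ C, ∀ g, ‖(m g : ℂ)‖ ≤ C), (∀ g, 0 ≤ m g) ∧
    (Summable fun g => m g ^ p.toReal) ∧ ∀ ξ, ‖T ξ‖ ≤ ‖diagOp (fun g => (m g : ℂ)) hb ξ‖

theorem IsDiagDominated.isSchatten {p : ℝ≥0∞} {T : Ell2 α →L[ℂ] Ell2 α}
    (h : IsDiagDominated p T) : IsSchatten p T := by
  unfold IsDiagDominated at h
  unfold IsSchatten
  split_ifs at h ⊢ with hp
  · exact h
  · obtain ⟨m, hb, hm, hs, hT⟩ := h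
    refine summable_absPow_of_norm_le_diagonal (orthonormal_delta α) (fun ξ => ?_) ?_ hm
      (fun g => diagOp_delta _ hb g) hT ENNReal.toReal_nonneg hs
    · simp only [inner_delta_left]
      rw [norm_sq_eq_tsum]
      exact (summable_norm_sq ξ).hasSum
    · have hb' : ∃ C, ∀ g, ‖(starRingEnd ℂ) (m g : ℂ)‖ ≤ C := by
        simpa using hb
      change ContinuousLinearMap.adjoint _ = _
      rw [adjoint_diagOp _ hb hb']
      simp

theorem IsDiagDominated.add {p : ℝ≥0∞} (hp : 1 ≤ p) {S T : Ell2 α →L[ℂ] Ell2 α}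
    (hS : IsDiagDominated p S) (hT : IsDiagDominated p T) : IsDiagDominated p (S + T) := by
  unfold IsDiagDominated at *
  split_ifs at * with h
  · exact hS.add hT
  · obtain ⟨m, ⟨C, hC⟩, hm, hms, hmS⟩ := hS
    obtain ⟨n, ⟨D, hD⟩, hn, hns, hnT⟩ := hT
    have hp1 : 1 ≤ p.toReal := by
      rw [← ENNReal.toReal_one]
      exact ENNReal.toReal_mono h hp
    -- The factor 2 lets each of ‖Sξ‖ and ‖Tξ‖ be at most half the norm of the diagonal operator 2(m
    -- + n) at ξ.
    have hb : ∃ E, ∀ g, ‖((2 * (m g + n g) : ℝ) : ℂ)‖ ≤ E := by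
      refine ⟨2 * (C + D), fun g => ?_⟩
      have h1 := hC g
      have h2 := hD g
      rw [Complex.norm_of_nonneg (hm g)] at h1
      rw [Complex.norm_of_nonneg (hn g)] at h2
      have := hm g
      have := hn g
      rw [Complex.norm_of_nonneg (by positivity)]
      linarith
    refine ⟨fun g => 2 * (m g + n g), hb, fun g => ?_, ?_, fun ξ => ?_⟩
    · have := hm g
      have := hn g
      positivity
    · have h1 := (hms.add hns).mul_left (2 ^ p.toReal * 2 ^ (p.toReal - 1))
      refine Summable.of_nonneg_of_le (fun g => ?_) (fun g => ?_) h1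
      · have := hm g
        have := hn g
        positivity
      · rw [Real.mul_rpow zero_le_two (add_nonneg (hm g) (hn g)), mul_assoc]
        refine mul_le_mul_of_nonneg_left ?_ (by positivity)
        exact_mod_cast NNReal.rpow_add_le_mul_rpow_add_rpow ⟨m g, hm g⟩ ⟨n g, hn g⟩ hp1
    · have e : ‖diagOp _ hb ξ‖ / 2 + ‖diagOp _ hb ξ‖ / 2 = ‖diagOp _ hb ξ‖ := add_halves _
      have half : ∀ (k : α → ℝ) (hk : ∃ C, ∀ g, ‖(k g : ℂ)‖ ≤ C), (∀ g, 0 ≤ k g) →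
          (∀ g, k g ≤ m g + n g) → ‖diagOp (fun g => (k g : ℂ)) hk ξ‖ ≤ ‖diagOp _ hb ξ‖ / 2 := by
        intro k hk hk0 hkm
        have h2 : ‖diagOp _ hb ξ‖ / 2 = ‖((1 / 2 : ℝ) : ℂ) • diagOp _ hb ξ‖ := by
          rw [norm_smul, Complex.norm_of_nonneg (by norm_num)]
          ring
        rw [h2]
        refine norm_le_norm_of_forall fun g => ?_
        rw [lp.coeFn_smul, Pi.smul_apply, diagOp_apply, diagOp_apply, smul_eq_mul, ← mul_assoc,
          ← Complex.ofReal_mul, norm_mul, norm_mul, Complex.norm_of_nonneg (hk0 g),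
          Complex.norm_of_nonneg (by have := hm g; have := hn g; positivity)]
        gcongr
        linarith [hkm g]
      calc ‖(S + T) ξ‖ ≤ ‖S ξ‖ + ‖T ξ‖ := norm_add_le _ _
        _ ≤ ‖diagOp _ hb ξ‖ / 2 + ‖diagOp _ hb ξ‖ / 2 :=
          add_le_add ((hmS ξ).trans (half m _ hm fun g => le_add_of_nonneg_right (hn g)))
            ((hnT ξ).trans (half n _ hn fun g => le_add_of_nonneg_left (hm g)))
        _ = _ := e

theorem IsDiagDominated.smul {p : ℝ≥0∞} {T : Ell2 α →L[ℂ] Ell2 α} (c : ℂ)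
    (hT : IsDiagDominated p T) : IsDiagDominated p (c • T) := by
  unfold IsDiagDominated at *
  split_ifs at * with h
  · exact hT.smul c
  · obtain ⟨m, ⟨C, hC⟩, hm, hms, hmT⟩ := hT
    have hb : ∃ E, ∀ g, ‖((‖c‖ * m g : ℝ) : ℂ)‖ ≤ E := by
      refine ⟨‖c‖ * C, fun g => ?_⟩
      rw [Complex.ofReal_mul, norm_mul, Complex.norm_of_nonneg (norm_nonneg c)]
      gcongr
      exact hC g
    refine ⟨fun g => ‖c‖ * m g, hb, fun g => mul_nonneg (norm_nonneg c) (hm g), ?_, fun ξ => ?_⟩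
    · refine (hms.mul_left (‖c‖ ^ p.toReal)).congr fun g => ?_
      rw [Real.mul_rpow (norm_nonneg c) (hm g)]
    · have e : ‖diagOp _ hb ξ‖ = ‖c‖ * ‖diagOp (fun g => (m g : ℂ)) ⟨C, hC⟩ ξ‖ := by
        have h1 : diagOp _ hb ξ = ((‖c‖ : ℝ) : ℂ) • diagOp (fun g => (m g : ℂ)) ⟨C, hC⟩ ξ := by
          refine Ell2.ext_inner fun g => ?_
          rw [lp.coeFn_smul, Pi.smul_apply, diagOp_apply, diagOp_apply, smul_eq_mul,
            Complex.ofReal_mul, mul_assoc]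
        rw [h1, norm_smul, Complex.norm_of_nonneg (norm_nonneg c)]
      rw [e, smul_apply, norm_smul]
      gcongr
      exact hmT ξ

/-- Cutting c off to a finite set gives finite rank, and the norm error is at most ε/2 once the set
contains all g with |c(g)| ≥ ε/2. -/
theorem isCompactOperator_diagOp {c : α → ℂ} (hb : ∃ C, ∀ g, ‖c g‖ ≤ C)
    (hc : Filter.Tendsto c Filter.cofinite (𝓝 0)) : IsCompactOperator (diagOp c hb) := by
  classical
  obtain ⟨C, hC⟩ := hb
  have hF : ∀ F : Finset α, ∃ C, ∀ g, ‖if g ∈ F then c g else 0‖ ≤ C := by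
    refine fun F => ⟨C, fun g => ?_⟩
    split_ifs
    · exact hC g
    · rw [norm_zero]
      exact (norm_nonneg _).trans (hC g)
  have hcomp : ∀ F : Finset α, IsCompactOperator (diagOp _ (hF F)) := by
    intro F
    have e : diagOp _ (hF F)
        = ∑ g ∈ F, (innerSL ℂ (delta g : Ell2 α)).smulRight (c g • (delta g : Ell2 α)) := by
      refine clm_ext fun a => ?_
      rw [diagOp_delta, sum_apply]
      simp [inner_delta_left, delta_apply]
    rw [e]
    refine Finset.sum_induction _ (fun T : Ell2 α →L[ℂ] Ell2 α => IsCompactOperator T)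
      (fun S T hS hT => hS.add hT) isCompactOperator_zero fun g _ => ?_
    exact (isCompactOperator_of_locallyCompactSpace_dom
      (innerSL ℂ (delta g : Ell2 α))).clm_comp
      ((ContinuousLinearMap.id ℂ ℂ).smulRight (c g • (delta g : Ell2 α)))
  refine isCompactOperator_of_tendsto (l := Filter.atTop) (F := fun F => diagOp _ (hF F)) ?_
    (Filter.Eventually.of_forall hcomp)
  rw [Metric.tendsto_nhds]
  intro ε hε
  have hfin : {g | ¬ ‖c g‖ < ε / 2}.Finite := by
    have h := (Metric.tendsto_nhds.1 hc) (ε / 2) (half_pos hε)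
    simpa [Filter.eventually_cofinite] using h
  filter_upwards [Filter.eventually_ge_atTop hfin.toFinset] with F hFs
  rw [dist_eq_norm]
  refine lt_of_le_of_lt (ContinuousLinearMap.opNorm_le_bound _ (half_pos hε).le fun ξ => ?_)
    (half_lt_self hε)
  have e : ε / 2 * ‖ξ‖ = ‖((ε / 2 : ℝ) : ℂ) • ξ‖ := by
    rw [norm_smul, Complex.norm_of_nonneg (half_pos hε).le]
  rw [e]
  refine norm_le_norm_of_forall fun g => ?_
  rw [sub_apply, lp.coeFn_sub, Pi.sub_apply, diagOp_apply, diagOp_apply, lp.coeFn_smul,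
    Pi.smul_apply, ← sub_mul, smul_eq_mul, norm_mul, norm_mul,
    Complex.norm_of_nonneg (half_pos hε).le]
  gcongr
  split_ifs with hg
  · simpa using (half_pos hε).le
  · rw [zero_sub, norm_neg]
    by_contra hlt
    exact hg (hFs (hfin.mem_toFinset.2 fun h => hlt h.le))

end DiagDominated

section Translations

variable {Γ : Type*} [Group Γ]

theorem norm_leftTranslation (g : Γ) (ξ : Ell2 Γ) : ‖leftTranslation g ξ‖ = ‖ξ‖ :=
  (l2Map (mulLeftEmbedding g)).norm_map ξ

theorem norm_rightTranslation (g : Γ) (ξ : Ell2 Γ) : ‖rightTranslation g ξ‖ = ‖ξ‖ :=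
  (l2Map (mulRightEmbedding g)).norm_map ξ

theorem isDiagDominated_translation {p : ℝ≥0∞} (s t : Γ) {c : Γ → ℂ}
    (hb : ∃ C, ∀ g, ‖c g‖ ≤ C) (hc : p = ∞ → Filter.Tendsto c Filter.cofinite (𝓝 0))
    (hc' : p ≠ ∞ → Summable fun g => ‖c g‖ ^ p.toReal) :
    IsDiagDominated p (leftTranslation s ∘L rightTranslation t ∘L diagOp c hb) := by
  unfold IsDiagDominated
  split_ifs with h
  · exact ((isCompactOperator_diagOp hb (hc h)).clm_comp (rightTranslation t)).clm_comp
      (leftTranslation s)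
  · refine ⟨fun g => ‖c g‖, by simpa using hb, fun g => norm_nonneg _, hc' h, fun ξ => ?_⟩
    rw [ContinuousLinearMap.comp_apply, ContinuousLinearMap.comp_apply, norm_leftTranslation,
      norm_rightTranslation]
    refine norm_le_norm_of_forall fun g => ?_
    rw [diagOp_apply, diagOp_apply, norm_mul, norm_mul, Complex.norm_of_nonneg (norm_nonneg _)]

/-- Matrix coefficients of Schatten operators along the permutation `g ↦ sgt`. -/
theorem IsSchatten.coefficients {p : ℝ≥0∞} (hp : 1 ≤ p) {T : Ell2 Γ →L[ℂ] Ell2 Γ}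
    (hT : IsSchatten p T) (s t : Γ) :
    (∃ C, ∀ g, ‖T (delta g) (s * g * t)‖ ≤ C) ∧
    (p = ∞ → Filter.Tendsto (fun g => T (delta g) (s * g * t)) Filter.cofinite (𝓝 0)) ∧
    (p ≠ ∞ → Summable fun g => ‖T (delta g) (s * g * t)‖ ^ p.toReal) := by
  have hle : ∀ g, ‖T (delta g) (s * g * t)‖ ≤ ‖T (delta g)‖ := fun g =>
    lp.norm_apply_le_norm (by simp) _ _
  refine ⟨⟨‖T‖, fun g => (hle g).trans ?_⟩, fun h => ?_, fun h => ?_⟩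
  · have := T.le_opNorm (delta g)
    rwa [(orthonormal_delta Γ).1 g, mul_one] at this
  · unfold IsSchatten at hT
    rw [if_pos h] at hT
    exact squeeze_zero_norm hle
      (tendsto_zero_iff_norm_tendsto_zero.1 (tendsto_delta_of_isCompactOperator hT))
  · unfold IsSchatten at hT
    rw [if_neg h] at hT
    have hp1 : 1 ≤ p.toReal := by
      rw [← ENNReal.toReal_one]
      exact ENNReal.toReal_mono h hp
    have hinj : Function.Injective fun g : Γ => s * g * t := fun g h e =>
      mul_left_cancel (mul_right_cancel e)
    have := summable_inner_rpow_of_schatten hp1 hT ((orthonormal_delta Γ).comp _ hinj)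
    simpa only [Function.comp_apply, inner_delta_left] using this

end Translations

/-! ### The gradient condition for multiplier semigroups -/

section Gradient

variable {Γ : Type*} [Group Γ] {ψ : Γ → ℝ}

/-- The generator of the multiplier semigroup on `ℂ[Γ]`. -/
def IsNegDefFun.algGenerator (hψ : IsNegDefFun ψ) : MonoidAlgebra ℂ Γ →ₗ[ℂ] Ell2 Γ :=
  hψ.semigroup.generator.toFun ∘ₗ vec.codRestrict _ hψ.vec_mem_domain

theorem IsNegDefFun.algGenerator_of (hψ : IsNegDefFun ψ) (g : Γ) :
    hψ.algGenerator (MonoidAlgebra.of ℂ Γ g) = (ψ g : ℂ) • delta g :=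
  LinearPMap.mem_graph_snd_inj _
    (LinearPMap.mem_graph hψ.semigroup.generator
      ⟨vec (MonoidAlgebra.of ℂ Γ g), hψ.vec_mem_domain _⟩)
    (hψ.delta_mem_graph g) (vec_of g)

/-- The expression `Δ(axb) + aΔ(x)b - Δ(ax)b - aΔ(xb)`. -/
def gradientForm (L : MonoidAlgebra ℂ Γ →ₗ[ℂ] Ell2 Γ) (a b x : MonoidAlgebra ℂ Γ) : Ell2 Γ :=
  L (a * x * b) + leftAct a (rightAct b (L x)) - rightAct b (L (a * x)) - leftAct a (L (x * b))

variable (L : MonoidAlgebra ℂ Γ →ₗ[ℂ] Ell2 Γ)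

theorem gradientForm_add_left (a a' b x : MonoidAlgebra ℂ Γ) :
    gradientForm L (a + a') b x = gradientForm L a b x + gradientForm L a' b x := by
  simp only [gradientForm, add_mul, map_add, leftAct_add, add_apply]
  abel

theorem gradientForm_add_middle (a b b' x : MonoidAlgebra ℂ Γ) :
    gradientForm L a (b + b') x = gradientForm L a b x + gradientForm L a b' x := by
  simp only [gradientForm, mul_add, map_add, rightAct_add, add_apply]
  abel

theorem gradientForm_add_right (a b x x' : MonoidAlgebra ℂ Γ) :
    gradientForm L a b (x + x') = gradientForm L a b x + gradientForm L a b x' := by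
  simp only [gradientForm, mul_add, add_mul, map_add]
  abel

theorem gradientForm_smul_left (c : ℂ) (a b x : MonoidAlgebra ℂ Γ) :
    gradientForm L (c • a) b x = c • gradientForm L a b x := by
  simp only [gradientForm, smul_mul_assoc, map_smul, leftAct_smul, smul_apply, smul_add, smul_sub]

theorem gradientForm_smul_middle (c : ℂ) (a b x : MonoidAlgebra ℂ Γ) :
    gradientForm L a (c • b) x = c • gradientForm L a b x := by
  simp only [gradientForm, mul_smul_comm, map_smul, rightAct_smul, smul_apply, smul_add, smul_sub]

theorem gradientForm_smul_right (c : ℂ) (a b x : MonoidAlgebra ℂ Γ) :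
    gradientForm L a b (c • x) = c • gradientForm L a b x := by
  simp only [gradientForm, mul_smul_comm, smul_mul_assoc, map_smul, smul_add, smul_sub]

variable {L}

/-- The gradient form is implemented by dominated operators as soon as this holds on group
elements. -/
theorem exists_gradient_operator {p : ℝ≥0∞} (hp : 1 ≤ p)
    (h : ∀ s t : Γ, ∃ T : Ell2 Γ →L[ℂ] Ell2 Γ, IsDiagDominated p T ∧ ∀ g, T (delta g)
      = (-(1 / 2) : ℂ) • gradientForm L (MonoidAlgebra.of ℂ Γ s) (MonoidAlgebra.of ℂ Γ t)
        (MonoidAlgebra.of ℂ Γ g))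
    (a b : MonoidAlgebra ℂ Γ) : ∃ T : Ell2 Γ →L[ℂ] Ell2 Γ, IsDiagDominated p T ∧
      ∀ x, T (vec x) = (-(1 / 2) : ℂ) • gradientForm L a b x := by
  induction a using MonoidAlgebra.induction_on with
  | of s =>
    induction b using MonoidAlgebra.induction_on with
    | of t =>
      obtain ⟨T, hT, hTg⟩ := h s t
      refine ⟨T, hT, fun x => ?_⟩
      induction x using MonoidAlgebra.induction_on with
      | of g => rw [vec_of, hTg]
      | add x y hx hy => rw [map_add, map_add, hx, hy, gradientForm_add_right, smul_add]
      | smul c x hx => rw [map_smul, map_smul, hx, gradientForm_smul_right, smul_comm]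
    | add b b' hb hb' =>
      obtain ⟨T, hT, hTx⟩ := hb
      obtain ⟨S, hS, hSx⟩ := hb'
      refine ⟨T + S, hT.add hp hS, fun x => ?_⟩
      rw [add_apply, hTx, hSx, gradientForm_add_middle, smul_add]
    | smul c b hb =>
      obtain ⟨T, hT, hTx⟩ := hb
      refine ⟨c • T, hT.smul c, fun x => ?_⟩
      rw [smul_apply, hTx, gradientForm_smul_middle, smul_comm]
  | add a a' ha ha' =>
    obtain ⟨T, hT, hTx⟩ := ha
    obtain ⟨S, hS, hSx⟩ := ha'
    refine ⟨T + S, hT.add hp hS, fun x => ?_⟩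
    rw [add_apply, hTx, hSx, gradientForm_add_left, smul_add]
  | smul c a ha =>
    obtain ⟨T, hT, hTx⟩ := ha
    refine ⟨c • T, hT.smul c, fun x => ?_⟩
    rw [smul_apply, hTx, gradientForm_smul_left, smul_comm]

/-- The coefficient `-½ (ψ(sgt) + ψ(g) - ψ(sg) - ψ(gt))`. -/
def gradientCoeff (ψ : Γ → ℝ) (s t g : Γ) : ℂ :=
  (-(1 / 2) : ℂ) * (ψ (s * g * t) + ψ g - ψ (s * g) - ψ (g * t))

/-- On group elements all four terms are multiples of δ_{sgt}, so the gradient operator is λ_s ρ_t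
composed with multiplication by the coefficient. -/
theorem IsNegDefFun.isGradientSchatten (hψ : IsNegDefFun ψ) {p : ℝ≥0∞} (hp : 1 ≤ p)
    (hb : ∀ s t, ∃ C, ∀ g, ‖gradientCoeff ψ s t g‖ ≤ C)
    (hc : ∀ s t, p = ∞ → Filter.Tendsto (gradientCoeff ψ s t) Filter.cofinite (𝓝 0))
    (hc' : ∀ s t, p ≠ ∞ → Summable fun g => ‖gradientCoeff ψ s t g‖ ^ p.toReal) :
    hψ.semigroup.IsGradientSchatten p := by
  refine ⟨hψ.vec_mem_domain, fun a b => ?_⟩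
  obtain ⟨T, hT, hTx⟩ := exists_gradient_operator (L := hψ.algGenerator) hp (fun s t =>
    ⟨_, isDiagDominated_translation s t (hb s t) (hc s t) (hc' s t), fun g => by
      simp only [gradientForm, ← _root_.map_mul, hψ.algGenerator_of, leftAct_of, rightAct_of,
        ContinuousLinearMap.comp_apply, diagOp_delta, map_smul, leftTranslation_delta,
        rightTranslation_delta, mul_assoc, gradientCoeff]
      rw [← add_smul, ← sub_smul, ← sub_smul, smul_smul]⟩) a b
  exact ⟨T, hT.isSchatten, fun x => hTx x⟩

/-- The translations in the gradient carry the coordinate sgt of the four terms to the diagonal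
coefficients of Δ at sgt, g, sg and gt. Off-diagonal coefficients of Δ never enter, so only ψ
appears. -/
theorem QMS.gradient_apply (Φ : QMS Γ) (hdom : ∀ x : MonoidAlgebra ℂ Γ, vec x ∈ Φ.generator.domain)
    {s t : Γ} {T : Ell2 Γ →L[ℂ] Ell2 Γ}
    (hT : ∀ x : MonoidAlgebra ℂ Γ, T (vec x) = (-(1 / 2) : ℂ) •
      (Φ.generator ⟨vec (MonoidAlgebra.of ℂ Γ s * x * MonoidAlgebra.of ℂ Γ t), hdom _⟩
        + leftAct (MonoidAlgebra.of ℂ Γ s) (rightAct (MonoidAlgebra.of ℂ Γ t)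
          (Φ.generator ⟨vec x, hdom _⟩))
        - rightAct (MonoidAlgebra.of ℂ Γ t)
          (Φ.generator ⟨vec (MonoidAlgebra.of ℂ Γ s * x), hdom _⟩)
        - leftAct (MonoidAlgebra.of ℂ Γ s)
          (Φ.generator ⟨vec (x * MonoidAlgebra.of ℂ Γ t), hdom _⟩))) (g : Γ) :
    T (delta g) (s * g * t) = gradientCoeff (Φ.length hdom) s t g := by
  have key : ∀ (x : MonoidAlgebra ℂ Γ) (k : Γ), x = MonoidAlgebra.of ℂ Γ k →
      Φ.generator ⟨vec x, hdom x⟩ k = (Φ.length hdom k : ℂ) := by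
    rintro _ k rfl
    have e : (⟨vec (MonoidAlgebra.of ℂ Γ k), hdom _⟩ : Φ.generator.domain)
        = ⟨delta k, vec_of k ▸ hdom _⟩ := Subtype.ext (vec_of k)
    rw [e, Φ.generator_delta_apply hdom]
  have h := congrArg (fun ξ : Ell2 Γ => ξ (s * g * t)) (hT (MonoidAlgebra.of ℂ Γ g))
  simp only [leftAct_of, rightAct_of] at h
  rw [← vec_of, h, lp.coeFn_smul, Pi.smul_apply, lp.coeFn_sub, Pi.sub_apply, lp.coeFn_sub, Pi.sub_apply,
    lp.coeFn_add, Pi.add_apply, leftTranslation_apply, leftTranslation_apply,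
    rightTranslation_apply, rightTranslation_apply, smul_eq_mul, gradientCoeff,
    show s⁻¹ * (s * g * t) * t⁻¹ = g by group, show s * g * t * t⁻¹ = s * g by group,
    show s⁻¹ * (s * g * t) = g * t by group, key _ (s * g * t) (by simp), key _ g rfl,
    key _ (s * g) (by simp), key _ (g * t) (by simp)]

end Gradient

end GroupQMS

end

/-! ### The main theorem -/

theorem mainTheorem11 {Γ : Type*} [Group Γ] (p : ENNReal) (hp : 1 ≤ p) (Φ : GroupQMS.QMS Γ)
    (hdom : ∀ x : MonoidAlgebra ℂ Γ, GroupQMS.vec x ∈ Φ.generator.domain)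
    (hΦ : Φ.IsGradientSchatten p) :
    ∃ D₀ : GroupQMS.Ell2 Γ →ₗ.[ℂ] GroupQMS.Ell2 Γ,
      Φ.IsAveragedPregenerator D₀ ∧ D₀.IsClosable ∧
      ∃ Θ : GroupQMS.QMS Γ,
        Θ.generator = D₀.closure ∧
        (∀ t, ∃ φ : Γ → ℂ, ∀ g,
          Θ.toFun t (GroupQMS.groupUnitary g) = φ g • GroupQMS.groupUnitary g) ∧
        Θ.IsGradientSchatten p := by
  have hψ := Φ.isNegDefFun_length hdom
  refine ⟨hψ.pregenerator, Φ.isAveragedPregenerator hdom, hψ.isClosable_pregenerator,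
    hψ.semigroup, hψ.generator_eq_closure,
    fun t => ⟨_, fun g => hψ.semigroup_groupUnitary t g⟩, ?_⟩
  obtain ⟨hdom', hT⟩ := hΦ
  have h : ∀ s t : Γ, (∃ C, ∀ g, ‖GroupQMS.gradientCoeff (Φ.length hdom) s t g‖ ≤ C) ∧
      (p = ⊤ → Filter.Tendsto (GroupQMS.gradientCoeff (Φ.length hdom) s t) Filter.cofinite
        (nhds 0)) ∧
      (p ≠ ⊤ → Summable fun g =>
        ‖GroupQMS.gradientCoeff (Φ.length hdom) s t g‖ ^ p.toReal) := fun s t => by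
    obtain ⟨T, hTS, hTx⟩ := hT (MonoidAlgebra.of ℂ Γ s) (MonoidAlgebra.of ℂ Γ t)
    -- All information needed from Φ is the family of entries of T along g ↦ sgt; these are the
    -- gradient coefficients of the averaged semigroup.
    have h2 := hTS.coefficients hp s t
    simp only [Φ.gradient_apply hdom hTx] at h2
    exact h2
  exact hψ.isGradientSchatten hp (fun s t => (h s t).1) (fun s t => (h s t).2.1)
    (fun s t => (h s t).2.2)
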